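/- Let $d\ge 1$, let $\Omega\subset\mathbb{R}^d$ be a bounded open set, and let $\mathcal T_h$ be a mesh of $\Omega$, i.e. a finite set of pairwise disjoint open $d$-simplices $T\subset\Omega$ with $\overline\Omega=\bigcup_{T\in\mathcal T_h}\overline T$. Let $\nu>0$ and $y_d,u_d\in L^2(\Omega)$. Let $(\cdot,\cdot)$ denote the $L^2(\Omega)$ scalar product, put $a(y,v):=(\nabla y,\nabla v)$ for $y,v\in H^1_0(\Omega)$, and let $$V_h:=\{v_h\in H^1_0(\Omega): v_h|_T\in\mathbb P_1(T)\ \text{for all } T\in\mathcal T_h\},$$ where $\mathbb P_1$ is the space of polynomials of degree at most $1$. Consider the variationally discretized problem $$(\mathrm{P}_h)\qquad\begin{aligned}&\min_{(y_h,u)\in V_h\times L^2(\Omega)} J(y_h,u):=\tfrac12\|y_h-y_d\|_{L^2(\Omega)}^2+\tfrac\nu2\|u-u_d\|_{L^2(\Omega)}^2\\ &\text{s.t. } a(y_h,v_h-y_h)+\|v_h\|_{L^1(\Omega)}-\|y_h\|_{L^1(\Omega)}\ge (u,v_h-y_h)\quad\text{for all } v_h\in V_h.\end{aligned}$$ Then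 the form $a$ is coercive: there is $c>0$ with $$a(v,v)\ge c\,\|v\|_{H^1(\Omega)}^2\quad\text{for all } v\in H^1_0(\Omega).\tag{1}$$ Moreover, let $\bar u_h$, with associated state $\bar y_h$, be a locally optimal solution of $(\mathrm{P}_h)$, i.e. $(\bar y_h,\bar u_h)$ is feasible and $J(\bar y_h,\bar u_h)\le J(y_h,u)$ for all feasible $(y_h,u)$ in some neighbourhood of $(\bar y_h,\bar u_h)$ in $H^1_0(\Omega)\times L^2(\Omega)$. Then $$\bar u_h-u_d\in V_h,$$ and for every $c>0$ that satisfies (1), $$\|\bar u_h-u_d\|_{H^1(\Omega)}\le\frac1{\nu c}\bigl(\|\bar y_h\|_{L^2(\Omega)}+\|y_d\|_{L^2(\Omega)}\bigr),$$ where $\|v\|_{H^1(\Omega)}^2=\|v\|_{L^2(\Omega)}^2+\|\nabla v\|_{L^2(\Omega)}^2$. -/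

import Mathlib

open MeasureTheory Set
open scoped ContDiff

noncomputable section

namespace DiscreteVI

/-- `ℝᵈ` with the Euclidean norm. -/
abbrev Rd (d : ℕ) : Type := EuclideanSpace ℝ (Fin d)

variable {d : ℕ}

/-- The real Hilbert space `L²(Ω)`. -/
abbrev L2 (Ω : Set (Rd d)) : Type := Lp ℝ 2 (volume.restrict Ω)

/-- The Hilbert space `L²(Ω)ᵈ` of square integrable vector fields. -/
abbrev L2Vec (Ω : Set (Rd d)) : Type := Lp (Rd d) 2 (volume.restrict Ω)

/-- The ambient Hilbert space `L²(Ω) × L²(Ω)ᵈ` of pairs `(v, G)`, normed by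
`‖(v, G)‖² = ‖v‖² + ‖G‖²`. A Sobolev function `v` is represented by the pair `(v, ∇v)`, so that
the norm of this space is the full `H¹(Ω)` norm. -/
abbrev Pair (Ω : Set (Rd d)) : Type := WithLp 2 (L2 Ω × L2Vec Ω)

/-- Smooth functions with compact support contained in `Ω`. -/
structure IsTestFunction (Ω : Set (Rd d)) (φ : Rd d → ℝ) : Prop where
  smooth : ContDiff ℝ ∞ φ
  hasCompactSupport : HasCompactSupport φ
  tsupport_subset : tsupport φ ⊆ Ω

/-- The pairs `(φ, ∇φ)`, with `φ` a smooth function with compact support in `Ω`. -/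
def testPairs (Ω : Set (Rd d)) : Set (Pair Ω) :=
  {w | ∃ φ : Rd d → ℝ, IsTestFunction Ω φ ∧
    w.fst =ᵐ[volume.restrict Ω] φ ∧ w.snd =ᵐ[volume.restrict Ω] gradient φ}

/-- `H¹₀(Ω)`: the closure of `C_c^∞(Ω)` with respect to the `H¹` norm. An element `w` consists of a
function `w.fst ∈ L²(Ω)` and of its weak gradient `w.snd = ∇ w.fst`, see
`isWeakGradient_of_mem_H10` and `IsWeakGradient.unique`. -/
def H10 (Ω : Set (Rd d)) : Submodule ℝ (Pair Ω) :=
  (Submodule.span ℝ (testPairs Ω)).topologicalClosure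

/-- `G` is the weak (distributional) gradient of `v` in `Ω`. -/
def IsWeakGradient (Ω : Set (Rd d)) (v : L2 Ω) (G : L2Vec Ω) : Prop :=
  ∀ ψ : Rd d → ℝ, IsTestFunction Ω ψ → ∀ e : Rd d,
    ∫ x in Ω, v x * fderiv ℝ ψ x e = - ∫ x in Ω, inner ℝ (G x) e * ψ x

theorem isWeakGradient_of_mem_H10 {Ω : Set (Rd d)} {w : Pair Ω} (hw : w ∈ H10 Ω) :
    IsWeakGradient Ω w.fst w.snd := by
  intro ψ hψ e
  have hcd : Continuous fun x => fderiv ℝ ψ x e :=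
    (hψ.smooth.continuous_fderiv (by simp)).clm_apply continuous_const
  have hcs : HasCompactSupport fun x => fderiv ℝ ψ x e :=
    hψ.hasCompactSupport.fderiv_apply (𝕜 := ℝ) e
  have hg : MemLp (fun x => fderiv ℝ ψ x e) 2 (volume.restrict Ω) :=
    (hcd.memLp_of_hasCompactSupport hcs).restrict Ω
  have hf : MemLp (fun x => ψ x • e) 2 (volume.restrict Ω) := by
    refine MemLp.restrict Ω (Continuous.memLp_of_hasCompactSupport ?_ ?_)
    · exact hψ.smooth.continuous.smul continuous_const
    · exact hψ.hasCompactSupport.smul_right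
  have key : ∀ z : Pair Ω, inner ℝ (hg.toLp _) z.fst + inner ℝ (hf.toLp _) z.snd =
      (∫ x in Ω, z.fst x * fderiv ℝ ψ x e) + ∫ x in Ω, inner ℝ (z.snd x) e * ψ x := by
    intro z
    rw [L2.inner_def, L2.inner_def]
    congr 1
    · refine integral_congr_ae ?_
      filter_upwards [hg.coeFn_toLp] with x hx
      rw [hx]
      simp
    · refine integral_congr_ae ?_
      filter_upwards [hf.coeFn_toLp] with x hx
      rw [hx, real_inner_smul_left, real_inner_comm, mul_comm]
  let F : Pair Ω →L[ℝ] ℝ :=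
    (innerSL ℝ (hg.toLp _)).comp (WithLp.fstL 2 ℝ (L2 Ω) (L2Vec Ω)) +
      (innerSL ℝ (hf.toLp _)).comp (WithLp.sndL 2 ℝ (L2 Ω) (L2Vec Ω))
  have hF : ∀ z : Pair Ω, F z = inner ℝ (hg.toLp _) z.fst + inner ℝ (hf.toLp _) z.snd :=
    fun z => rfl
  have hle : H10 Ω ≤ LinearMap.ker F.toLinearMap := by
    refine Submodule.topologicalClosure_minimal _ (Submodule.span_le.2 ?_)
      (ContinuousLinearMap.isClosed_ker F)
    rintro z ⟨φ, hφ, h1, h2⟩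
    change F z = 0
    rw [hF, key]
    have e1 : ∫ x in Ω, z.fst x * fderiv ℝ ψ x e = ∫ x, φ x * fderiv ℝ ψ x e := by
      rw [← setIntegral_eq_integral_of_forall_compl_eq_zero (s := Ω)
        (f := fun x => φ x * fderiv ℝ ψ x e)]
      · refine integral_congr_ae ?_
        filter_upwards [h1] with x hx
        rw [hx]
      · intro x hx
        rw [image_eq_zero_of_notMem_tsupport fun h => hx (hφ.tsupport_subset h), zero_mul]
    have e2 : ∫ x in Ω, inner ℝ (z.snd x) e * ψ x = ∫ x, fderiv ℝ φ x e * ψ x := by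
      rw [← setIntegral_eq_integral_of_forall_compl_eq_zero (s := Ω)
        (f := fun x => fderiv ℝ φ x e * ψ x)]
      · refine integral_congr_ae ?_
        filter_upwards [h2] with x hx
        rw [hx, gradient, InnerProductSpace.toDual_symm_apply]
      · intro x hx
        rw [image_eq_zero_of_notMem_tsupport fun h => hx (hψ.tsupport_subset h), mul_zero]
    have hcφ : Continuous fun x => fderiv ℝ φ x e :=
      (hφ.smooth.continuous_fderiv (by simp)).clm_apply continuous_const
    rw [e1, e2, integral_mul_fderiv_eq_neg_fderiv_mul_of_integrable]
    · ring
    · exact (hcφ.mul hψ.smooth.continuous).integrable_of_hasCompactSupport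
        hψ.hasCompactSupport.mul_left
    · exact (hφ.smooth.continuous.mul hcd).integrable_of_hasCompactSupport hcs.mul_left
    · exact (hφ.smooth.continuous.mul hψ.smooth.continuous).integrable_of_hasCompactSupport
        hψ.hasCompactSupport.mul_left
    · exact fun x _ => hφ.smooth.differentiable (by simp) x
    · exact fun x _ => hψ.smooth.differentiable (by simp) x
  have h0 : F w = 0 := hle hw
  rw [hF, key] at h0
  linarith

theorem IsWeakGradient.unique {Ω : Set (Rd d)} (hΩ : IsOpen Ω) {v : L2 Ω} {G G' : L2Vec Ω}
    (hG : IsWeakGradient Ω v G) (hG' : IsWeakGradient Ω v G') : G = G' := by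
  have hloc : ∀ K : L2Vec Ω, LocallyIntegrableOn K Ω volume := by
    intro K
    exact locallyIntegrableOn_of_locallyIntegrable_restrict
      ((Lp.memLp K).locallyIntegrable (by norm_num))
  have hae : ∀ᵐ x ∂volume, x ∈ Ω → (G x - G' x) = 0 := by
    refine hΩ.ae_eq_zero_of_integral_contDiff_smul_eq_zero ((hloc G).sub (hloc G')) ?_
    intro ψ h1 h2 h3
    have hψ : IsTestFunction Ω ψ := ⟨h1, h2, h3⟩
    have hb : MemLp ψ 2 (volume.restrict Ω) :=
      (h1.continuous.memLp_of_hasCompactSupport h2).restrict Ω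
    have hint : ∀ K : L2Vec Ω, Integrable (fun x => ψ x • K x) (volume.restrict Ω) :=
      fun K => memLp_one_iff_integrable.1 ((Lp.memLp K).smul hb)
    have hz : (∫ x in Ω, ψ x • G x) = ∫ x in Ω, ψ x • G' x := by
      refine ext_inner_left ℝ fun e => ?_
      rw [← integral_inner (hint G), ← integral_inner (hint G')]
      have := (hG ψ hψ e).symm.trans (hG' ψ hψ e)
      have h : ∀ K : L2Vec Ω, (∫ x in Ω, inner ℝ e (ψ x • K x)) =
          ∫ x in Ω, inner ℝ (K x) e * ψ x := by
        intro K
        refine integral_congr_ae (Filter.Eventually.of_forall fun x => ?_)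
        simp only [real_inner_smul_right, real_inner_comm, mul_comm]
      rw [h, h]
      linarith
    rw [← setIntegral_eq_integral_of_forall_compl_eq_zero (s := Ω)]
    · simp only [smul_sub]
      rw [integral_sub (hint G) (hint G'), hz, sub_self]
    · intro x hx
      rw [image_eq_zero_of_notMem_tsupport fun h => hx (h3 h), zero_smul]
  refine Lp.ext ?_
  filter_upwards [(ae_restrict_iff' hΩ.measurableSet).2 hae] with x hx
  exact sub_eq_zero.1 hx

/-- A mesh of `Ω`: finitely many pairwise disjoint open `d`-simplices contained in `Ω` whose
closures cover `closure Ω`. Hanging nodes are not excluded. -/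
structure Mesh (Ω : Set (Rd d)) where
  /-- the simplices of the mesh -/
  cells : Finset (Affine.Simplex ℝ (Rd d) d)
  interior_subset : ∀ T ∈ cells, T.interior ⊆ Ω
  disjoint : ∀ T ∈ cells, ∀ T' ∈ cells, T ≠ T' → Disjoint T.interior T'.interior
  closure_eq : closure Ω = ⋃ T ∈ cells, T.closedInterior

/-- The finite element space `V_h = {v ∈ H¹₀(Ω) : v|_T ∈ ℙ₁(T) for all T}`. -/
def Vh {Ω : Set (Rd d)} (𝒯 : Mesh Ω) : Submodule ℝ (Pair Ω) where
  carrier := {w | w ∈ H10 Ω ∧ ∀ T ∈ 𝒯.cells, ∃ ℓ : Rd d →ᵃ[ℝ] ℝ,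
    w.fst =ᵐ[volume.restrict T.interior] ℓ}
  zero_mem' := by
    refine ⟨Submodule.zero_mem _, fun T hT => ⟨0, ?_⟩⟩
    exact ae_restrict_of_ae_restrict_of_subset (𝒯.interior_subset T hT)
      (Lp.coeFn_zero ℝ 2 (volume.restrict Ω))
  add_mem' := by
    rintro a b ⟨ha, ha'⟩ ⟨hb, hb'⟩
    refine ⟨Submodule.add_mem _ ha hb, fun T hT => ?_⟩
    obtain ⟨ℓ, h⟩ := ha' T hT
    obtain ⟨m, h'⟩ := hb' T hT
    refine ⟨ℓ + m, ?_⟩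
    have hs := ae_restrict_of_ae_restrict_of_subset (𝒯.interior_subset T hT)
      (Lp.coeFn_add a.fst b.fst)
    filter_upwards [h, h', hs] with x h1 h2 h3
    rw [WithLp.add_fst, h3, Pi.add_apply, h1, h2]
    rfl
  smul_mem' := by
    rintro c a ⟨ha, ha'⟩
    refine ⟨Submodule.smul_mem _ c ha, fun T hT => ?_⟩
    obtain ⟨ℓ, h⟩ := ha' T hT
    refine ⟨c • ℓ, ?_⟩
    have hs := ae_restrict_of_ae_restrict_of_subset (𝒯.interior_subset T hT)
      (Lp.coeFn_smul c a.fst)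
    filter_upwards [h, hs] with x h1 h3
    rw [WithLp.smul_fst, h3, Pi.smul_apply, h1]
    rfl

/-- The bilinear form `a(y, v) = (∇y, ∇v)`. -/
def a {Ω : Set (Rd d)} (y v : Pair Ω) : ℝ := inner ℝ y.snd v.snd

/-- `c` is a coercivity constant of `a` on `H¹₀(Ω)`: `c > 0` and `a(v, v) ≥ c ‖v‖²_{H¹(Ω)}`. -/
def IsCoercivityConstant (Ω : Set (Rd d)) (c : ℝ) : Prop :=
  0 < c ∧ ∀ v ∈ H10 Ω, c * ‖v‖ ^ 2 ≤ a v v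

/-- The `L¹(Ω)` norm. -/
def normL1 {Ω : Set (Rd d)} (v : L2 Ω) : ℝ := ∫ x in Ω, |v x|

/-- `(y, u)` is feasible: `y ∈ V_h` solves the discrete variational inequality
`a(y, v - y) + ‖v‖_{L¹} - ‖y‖_{L¹} ≥ (u, v - y)` for all `v ∈ V_h`. -/
def IsFeasible {Ω : Set (Rd d)} (𝒯 : Mesh Ω) (y : Pair Ω) (u : L2 Ω) : Prop :=
  y ∈ Vh 𝒯 ∧ ∀ v ∈ Vh 𝒯,
    inner ℝ u (v - y).fst ≤ a y (v - y) + normL1 v.fst - normL1 y.fst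

/-- The objective `J(y, u) = ½ ‖y - y_d‖² + ν/2 ‖u - u_d‖²`, with `L²(Ω)` norms. -/
def J {Ω : Set (Rd d)} (ν : ℝ) (yd ud : L2 Ω) (y : Pair Ω) (u : L2 Ω) : ℝ :=
  1 / 2 * ‖y.fst - yd‖ ^ 2 + ν / 2 * ‖u - ud‖ ^ 2

/-- `(ȳ, ū)` is a locally optimal solution of the variationally discretized control problem, local
with respect to the norm of `H¹₀(Ω) × L²(Ω)`. If `ū` minimizes the reduced functional in an
`L²(Ω)` ball and `ȳ` is its discrete state, then this holds a fortiori. -/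
def IsLocalSolution {Ω : Set (Rd d)} (𝒯 : Mesh Ω) (ν : ℝ) (yd ud : L2 Ω)
    (ybar : Pair Ω) (ubar : L2 Ω) : Prop :=
  IsFeasible 𝒯 ybar ubar ∧ ∃ ε > 0, ∀ (y : Pair Ω) (u : L2 Ω), IsFeasible 𝒯 y u →
    ‖y - ybar‖ ≤ ε → ‖u - ubar‖ ≤ ε → J ν yd ud ybar ubar ≤ J ν yd ud y u

end DiscreteVI

end

/-! Coercivity is the Poincaré inequality on a bounded set. For the rest, no multiplier system is
needed: `IsLocalSolution.first_order` is tested with three explicit families of feasible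
perturbations.

First, a control change orthogonal to the discrete functions leaves the variational inequality
intact, so `ubar - ud` is orthogonal to that orthogonal complement and hence lies in the
finite-dimensional space `VhFst` (`IsLocalSolution.sub_mem_VhFst`). Put `W = -(ubar - ud)`, now a
discrete function.

Second, with the state `ybar` fixed, the control may be moved so that the residual slides towards
any other subgradient of the L¹ norm at `ybar`. Choosing the subgradient that realizes the
directional derivative along `W` shows that `W` is a critical direction
(`IsLocalSolution.integral_absDeriv_le`).

Third, criticality allows the state to move along `ybar + t W`. The control must then absorb `t a(W,
·)` and the jump of the sign from `ybar` to `ybar + t W`. The jump is bounded and lives on a set of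
measure O(t), because a nonzero affine function is small only on a thin slab; its L² norm is thereby
bounded only by O(√t), which is too weak. Its projection onto `VhFst`, which acts identically on
test functions, is O(t), since there the maximum norm is bounded by the L² norm. As the jump pairs
nonnegatively with `W`, it can be dropped, leaving `ν a(W, W) ≤ (ybar - yd, W)`
(`IsLocalSolution.mul_a_le`). Coercivity and Cauchy–Schwarz finish. -/

noncomputable section

namespace DiscreteVI

variable {d : ℕ}

/-! ### Pointwise calculus of the absolute value -/

/-- The sign of a real number, as a real number. -/
def sgn (x : ℝ) : ℝ := if 0 < x then 1 else if x < 0 then -1 else 0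

theorem measurable_sgn : Measurable sgn :=
  Measurable.ite measurableSet_Ioi measurable_const
    (Measurable.ite measurableSet_Iio measurable_const measurable_const)

theorem abs_sgn_le (x : ℝ) : |sgn x| ≤ 1 := by
  unfold sgn; split_ifs <;> simp

theorem sgn_mul_self (x : ℝ) : sgn x * x = |x| := by
  unfold sgn; split_ifs with h h'
  · simp [abs_of_pos h]
  · simp [abs_of_neg h']
  · have : x = 0 := le_antisymm (not_lt.1 h) (not_lt.1 h')
    simp [this]

theorem sgn_mul_le (x y : ℝ) : sgn x * y ≤ |y| :=
  calc sgn x * y ≤ |sgn x * y| := le_abs_self _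
    _ = |sgn x| * |y| := abs_mul _ _
    _ ≤ 1 * |y| := by gcongr; exact abs_sgn_le x
    _ = |y| := one_mul _

/-- The directional derivative of the absolute value at `y` in direction `z`. -/
def absDeriv (y z : ℝ) : ℝ := if y = 0 then |z| else sgn y * z

/-- The subgradient of the absolute value at `y` that realizes the directional derivative in
direction `z`. -/
def absSubgrad (y z : ℝ) : ℝ := if y = 0 then sgn z else sgn y

/-- The change of the sign from `y` to `y + z`, where `y ≠ 0`. -/
def sgnJump (y z : ℝ) : ℝ := if y = 0 then 0 else sgn (y + z) - sgn y

theorem abs_absSubgrad_le (y z : ℝ) : |absSubgrad y z| ≤ 1 := by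
  unfold absSubgrad; split_ifs <;> exact abs_sgn_le _

theorem absSubgrad_mul_self (y z : ℝ) : absSubgrad y z * z = absDeriv y z := by
  unfold absSubgrad absDeriv; split_ifs
  · exact sgn_mul_self z
  · rfl

theorem absSubgrad_mul_sub_le (y z v : ℝ) : absSubgrad y z * (v - y) ≤ |v| - |y| := by
  unfold absSubgrad; split_ifs with h
  · subst h; simpa using sgn_mul_le z v
  · rw [mul_sub, sgn_mul_self]; linarith [sgn_mul_le y v]

theorem abs_sgnJump_le (y z : ℝ) : |sgnJump y z| ≤ 2 := by
  unfold sgnJump; split_ifs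
  · simp
  · exact (abs_sub _ _).trans (by linarith [abs_sgn_le (y + z), abs_sgn_le y])

/-- A step shorter than the distance to zero cannot change the sign. This localizes the jump to a
sublevel set of `|y|`. -/
theorem sgnJump_eq_zero {y z : ℝ} (h : ¬ (0 < |y| ∧ |y| ≤ |z|)) : sgnJump y z = 0 := by
  unfold sgnJump sgn
  rcases eq_or_ne y 0 with h0 | h0
  · simp [h0]
  have h1 : |z| < |y| := by
    by_contra h'
    exact h ⟨abs_pos.2 h0, not_lt.1 h'⟩
  rw [if_neg h0]
  rw [abs_lt] at h1
  rcases lt_or_gt_of_ne h0 with h2 | h2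
  · rw [abs_of_neg h2] at h1
    rw [if_neg (by linarith), if_pos (by linarith), if_neg (by linarith), if_pos h2]; ring
  · rw [abs_of_pos h2] at h1
    rw [if_pos (by linarith), if_pos h2]; ring

/-- Monotonicity of the sign. It gives the jump term the favourable sign in the final first order
condition. -/
theorem sgnJump_mul_nonneg (y z : ℝ) : 0 ≤ sgnJump y z * z := by
  unfold sgnJump; split_ifs with h
  · simp
  · have h1 := sgn_mul_self (y + z)
    have h2 := sgn_mul_self y
    have h3 := sgn_mul_le (y + z) y
    have h4 := sgn_mul_le y (y + z)
    nlinarith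

/-- For `y ≠ 0` the right side is `sgn (y + z) * z`, so this is the subgradient inequality at `y +
z`; the kink at `y = 0` is already contained in `absDeriv`. -/
theorem abs_add_sub_abs_le (y z : ℝ) : |y + z| - |y| ≤ absDeriv y z + sgnJump y z * z := by
  unfold absDeriv sgnJump; split_ifs with h
  · simp [h]
  · have h1 := sgn_mul_self (y + z)
    have h2 := sgn_mul_self y
    have h3 := sgn_mul_le (y + z) y
    nlinarith

theorem absDeriv_smul (y z : ℝ) {t : ℝ} (ht : 0 ≤ t) : absDeriv y (t * z) = t * absDeriv y z := by
  unfold absDeriv; split_ifs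
  · rw [abs_mul, abs_of_nonneg ht]
  · ring

theorem absDeriv_neg_self (y : ℝ) : absDeriv y (-y) = -|y| := by
  unfold absDeriv; split_ifs with h
  · simp [h]
  · rw [mul_neg, sgn_mul_self]

/-- For `y ≠ 0` the left side collapses to `sgn (y + z) * v - |y + z|`; for `y = 0` the two sides
agree. Integrated, it yields the variational inequality at the moved state. -/
theorem absDeriv_add_sgnJump_le (y z v : ℝ) :
    absDeriv y v - |y| - absDeriv y z + sgnJump y z * (v - (y + z)) ≤ |v| - |y + z| := by
  unfold absDeriv sgnJump; split_ifs with h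
  · simp [h]
  · have h1 := sgn_mul_self (y + z)
    have h2 := sgn_mul_self y
    have h3 := sgn_mul_le (y + z) v
    nlinarith

theorem measurable_absDeriv : Measurable fun p : ℝ × ℝ => absDeriv p.1 p.2 :=
  Measurable.ite (measurableSet_eq_fun measurable_fst measurable_const) measurable_snd.abs
    ((measurable_sgn.comp measurable_fst).mul measurable_snd)

theorem measurable_absSubgrad : Measurable fun p : ℝ × ℝ => absSubgrad p.1 p.2 :=
  Measurable.ite (measurableSet_eq_fun measurable_fst measurable_const)
    (measurable_sgn.comp measurable_snd) (measurable_sgn.comp measurable_fst)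

theorem measurable_sgnJump : Measurable fun p : ℝ × ℝ => sgnJump p.1 p.2 :=
  Measurable.ite (measurableSet_eq_fun measurable_fst measurable_const) measurable_const
    ((measurable_sgn.comp (measurable_fst.add measurable_snd)).sub
      (measurable_sgn.comp measurable_fst))

/-! ### Thin sublevel sets of affine functions -/

/-- On a bounded set, an affine function takes small nonzero values only on a small set. -/
theorem exists_measureReal_sublevel_le (ℓ : Rd d →ᵃ[ℝ] ℝ) {B : Set (Rd d)}
    (hB : Bornology.IsBounded B) :
    ∃ K : ℝ, 0 ≤ K ∧ ∀ ε > 0, volume.real {x | x ∈ B ∧ 0 < |ℓ x| ∧ |ℓ x| ≤ ε} ≤ K * ε := by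
  obtain ⟨R, hR0, hR⟩ : ∃ R : ℝ, 0 ≤ R ∧ B ⊆ Metric.closedBall 0 R := by
    obtain ⟨R, hR⟩ := hB.subset_closedBall 0
    exact ⟨max R 0, le_max_right _ _, hR.trans (Metric.closedBall_subset_closedBall (le_max_left _ _))⟩
  by_cases hlin : ∀ v, ℓ.linear v = 0
  · have hconst : ∀ x, ℓ x = ℓ 0 := fun x => by
      have := ℓ.map_vadd 0 x
      simpa [hlin x] using this
    by_cases h0 : ℓ 0 = 0
    · refine ⟨0, le_rfl, fun ε _ => ?_⟩
      simp [hconst, h0]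
    -- A nonzero constant has an empty sublevel set until `ε` reaches `|ℓ 0|`; from then on the
    -- volume of the ball suffices.
    · refine ⟨volume.real (Metric.closedBall (0 : Rd d) R) / |ℓ 0|, by positivity, fun ε hε => ?_⟩
      by_cases hle : |ℓ 0| ≤ ε
      · calc volume.real {x | x ∈ B ∧ 0 < |ℓ x| ∧ |ℓ x| ≤ ε}
            ≤ volume.real (Metric.closedBall (0 : Rd d) R) :=
              measureReal_mono (fun x hx => hR hx.1) measure_closedBall_lt_top.ne
          _ = volume.real (Metric.closedBall (0 : Rd d) R) / |ℓ 0| * |ℓ 0| := by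
              field_simp
          _ ≤ _ := by gcongr
      · have : {x | x ∈ B ∧ 0 < |ℓ x| ∧ |ℓ x| ≤ ε} = ∅ := by
          ext x; simp [hconst x]; intros; linarith
        rw [this]
        simp only [measureReal_empty]
        positivity
  · push Not at hlin
    obtain ⟨v, hv⟩ := hlin
    -- Moving by `s • e` raises `ℓ` by exactly `s`. Shifts of the slab by multiples of `3 * ε` are
    -- disjoint, as the slab has `ℓ`-width `2 * ε`; about `1 / (3 * ε)` of them fit into one fixed
    -- ball, so each has volume O(ε).
    obtain ⟨e, he⟩ : ∃ e, ℓ.linear e = 1 := ⟨(ℓ.linear v)⁻¹ • v, by simp [hv]⟩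
    set C := volume.real (Metric.closedBall (0 : Rd d) (R + ‖e‖)) with hC
    refine ⟨3 * C, by positivity, fun ε hε => ?_⟩
    set S : Set (Rd d) := {x | x ∈ Metric.closedBall (0 : Rd d) R ∧ |ℓ x| ≤ ε} with hS
    have hcont : Continuous ℓ := ℓ.continuous_of_finiteDimensional
    have hSm : MeasurableSet S :=
      (Metric.isClosed_closedBall.inter (isClosed_le hcont.abs continuous_const)).measurableSet
    have hSfin : volume S ≠ ⊤ :=
      ((measure_mono fun x hx => hx.1).trans_lt
        (measure_closedBall_lt_top (x := (0 : Rd d)) (r := R))).ne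
    set N : ℕ := ⌊(3 * ε)⁻¹⌋₊
    have hN : (3 * ε)⁻¹ < N + 1 := Nat.lt_floor_add_one _
    have hN' : (N : ℝ) ≤ (3 * ε)⁻¹ := Nat.floor_le (by positivity)
    let τ : ℕ → Set (Rd d) := fun k => (fun x => (-((3 * ε * k) • e)) + x) ⁻¹' S
    have hτ : ∀ k x, x ∈ τ k → |ℓ x - 3 * ε * k| ≤ ε := by
      intro k x hx
      have h2 : |ℓ (-((3 * ε * k) • e) + x)| ≤ ε := hx.2
      have := ℓ.map_vadd x (-((3 * ε * k) • e))
      simp only [vadd_eq_add, map_neg, map_smul, he, smul_eq_mul, mul_one] at this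
      rw [this] at h2
      convert! h2 using 2
      ring
    have hsub : (⋃ k ∈ Finset.range (N + 1), τ k) ⊆ Metric.closedBall 0 (R + ‖e‖) := by
      intro x hx
      simp only [mem_iUnion] at hx
      obtain ⟨k, hk, hx⟩ := hx
      have hk' : (k : ℝ) ≤ N := by
        exact_mod_cast Nat.lt_succ_iff.1 (Finset.mem_range.1 hk)
      have h1 : ‖-((3 * ε * k) • e) + x‖ ≤ R := by
        have := hx.1
        rwa [mem_closedBall_zero_iff] at this
      have h2 : 3 * ε * k ≤ 1 := by
        calc 3 * ε * k ≤ 3 * ε * (3 * ε)⁻¹ := by gcongr; linarith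
          _ = 1 := mul_inv_cancel₀ (by positivity)
      rw [mem_closedBall_zero_iff]
      calc ‖x‖ = ‖(-((3 * ε * k) • e) + x) + (3 * ε * k) • e‖ := by congr 1; abel
        _ ≤ R + ‖(3 * ε * k) • e‖ := (norm_add_le _ _).trans (by gcongr)
        _ ≤ R + 1 * ‖e‖ := by
          rw [norm_smul, Real.norm_of_nonneg (by positivity)]; gcongr
        _ = _ := by rw [one_mul]
    have hdisj : (↑(Finset.range (N + 1)) : Set ℕ).PairwiseDisjoint τ := by
      intro j _ k _ hjk
      refine Set.disjoint_left.2 fun x hj hk => ?_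
      have h1 := abs_le.1 (hτ j x hj)
      have h2 := abs_le.1 (hτ k x hk)
      rcases lt_or_gt_of_ne hjk with h | h
      · have : (j : ℝ) + 1 ≤ k := by exact_mod_cast h
        nlinarith
      · have : (k : ℝ) + 1 ≤ j := by exact_mod_cast h
        nlinarith
    have hτm : ∀ k, volume.real (τ k) = volume.real S := fun k => by
      simp only [measureReal_def, τ, measure_preimage_add]
    have hsum : ((N : ℝ) + 1) * volume.real S ≤ C := by
      calc ((N : ℝ) + 1) * volume.real S = ∑ k ∈ Finset.range (N + 1), volume.real (τ k) := by
            simp [hτm]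
        _ = volume.real (⋃ k ∈ Finset.range (N + 1), τ k) := by
            exact (measureReal_biUnion_finset hdisj (fun k _ => (measurable_const_add _) hSm)
              fun k _ => by rwa [measure_preimage_add]).symm
        _ ≤ C := measureReal_mono hsub measure_closedBall_lt_top.ne
    calc volume.real {x | x ∈ B ∧ 0 < |ℓ x| ∧ |ℓ x| ≤ ε} ≤ volume.real S :=
          measureReal_mono (fun x hx => ⟨hR hx.1, hx.2.2⟩) hSfin
      _ = 3 * ε * ((3 * ε)⁻¹ * volume.real S) := by field_simp
      _ ≤ 3 * ε * (((N : ℝ) + 1) * volume.real S) := by gcongr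
      _ ≤ 3 * ε * C := by gcongr
      _ = 3 * C * ε := by ring

/-! ### Poincaré inequality and coercivity -/

/-- Needed because the Poincaré inequality is quadratic and does not pass from generators to their
span by linearity. -/
theorem mem_testPairs_of_mem_span {Ω : Set (Rd d)} {w : Pair Ω}
    (hw : w ∈ Submodule.span ℝ (testPairs Ω)) : w ∈ testPairs Ω := by
  induction hw using Submodule.span_induction with
  | mem x h => exact h
  | zero =>
    refine ⟨fun _ => 0, ⟨contDiff_const, HasCompactSupport.zero, ?_⟩, ?_, ?_⟩
    · have : tsupport (fun _ : Rd d => (0 : ℝ)) = ∅ := tsupport_eq_empty_iff.2 rfl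
      simp [this]
    · exact Lp.coeFn_zero ℝ 2 (volume.restrict Ω)
    · filter_upwards [Lp.coeFn_zero (Rd d) 2 (volume.restrict Ω)] with x hx
      rw [WithLp.zero_snd, hx]
      simp [gradient]
  | add x y _ _ hx hy =>
    obtain ⟨φ, hφ, h1, h2⟩ := hx
    obtain ⟨ψ, hψ, h3, h4⟩ := hy
    refine ⟨φ + ψ, ⟨hφ.smooth.add hψ.smooth, hφ.hasCompactSupport.add hψ.hasCompactSupport,
      (tsupport_add φ ψ).trans (union_subset hφ.tsupport_subset hψ.tsupport_subset)⟩, ?_, ?_⟩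
    · filter_upwards [h1, h3, Lp.coeFn_add x.fst y.fst] with z h1 h3 h5
      rw [WithLp.add_fst, h5, Pi.add_apply, h1, h3, Pi.add_apply]
    · filter_upwards [h2, h4, Lp.coeFn_add x.snd y.snd] with z h2 h4 h5
      rw [WithLp.add_snd, h5, Pi.add_apply, h2, h4, gradient, gradient, gradient,
        fderiv_add (hφ.smooth.differentiable (by simp) z) (hψ.smooth.differentiable (by simp) z),
        map_add]
  | smul c x _ hx =>
    obtain ⟨φ, hφ, h1, h2⟩ := hx
    refine ⟨c • φ, ⟨contDiff_const.smul hφ.smooth, hφ.hasCompactSupport.smul_left,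
      (tsupport_smul_subset_right (fun _ => c) φ).trans hφ.tsupport_subset⟩, ?_, ?_⟩
    · filter_upwards [h1, Lp.coeFn_smul c x.fst] with z h1 h5
      rw [WithLp.smul_fst, h5, Pi.smul_apply, h1, Pi.smul_apply]
    · filter_upwards [h2, Lp.coeFn_smul c x.snd] with z h2 h5
      rw [WithLp.smul_snd, h5, Pi.smul_apply, h2, gradient, gradient,
        fderiv_const_smul (hφ.smooth.differentiable (by simp) z), map_smul]

theorem IsTestFunction.continuous_gradient {Ω : Set (Rd d)} {φ : Rd d → ℝ}
    (hφ : IsTestFunction Ω φ) : Continuous (gradient φ) :=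
  (InnerProductSpace.toDual ℝ (Rd d)).symm.continuous.comp
    (hφ.smooth.continuous_fderiv (by simp))

theorem IsTestFunction.integrable_sq {Ω : Set (Rd d)} {φ : Rd d → ℝ}
    (hφ : IsTestFunction Ω φ) : Integrable fun x => φ x ^ 2 := by
  have hcs : HasCompactSupport fun x => φ x ^ 2 :=
    hφ.hasCompactSupport.comp_left (g := fun t => t ^ 2) (by simp)
  exact (hφ.smooth.continuous.pow 2).integrable_of_hasCompactSupport hcs

theorem IsTestFunction.integrable_norm_gradient_sq {Ω : Set (Rd d)} {φ : Rd d → ℝ}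
    (hφ : IsTestFunction Ω φ) : Integrable fun x => ‖gradient φ x‖ ^ 2 := by
  have hgs : HasCompactSupport (gradient φ) :=
    (hφ.hasCompactSupport.fderiv (𝕜 := ℝ)).comp_left (map_zero _)
  have hcs : HasCompactSupport fun x => ‖gradient φ x‖ ^ 2 :=
    hgs.comp_left (g := fun v => ‖v‖ ^ 2) (by simp)
  exact (hφ.continuous_gradient.norm.pow 2).integrable_of_hasCompactSupport hcs

theorem IsTestFunction.integrable_mul_fderiv_mul {Ω : Set (Rd d)} {φ : Rd d → ℝ}
    (hφ : IsTestFunction Ω φ) (e : Rd d) (L : Rd d →L[ℝ] ℝ) :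
    Integrable fun x => 2 * φ x * fderiv ℝ φ x e * L x := by
  have hc := hφ.smooth.continuous
  have hc' : Continuous fun x => fderiv ℝ φ x e :=
    (hφ.smooth.continuous_fderiv (by simp)).clm_apply continuous_const
  have h1 : Continuous fun x => 2 * φ x * fderiv ℝ φ x e * L x :=
    ((continuous_const.mul hc).mul hc').mul L.continuous
  have h2 : HasCompactSupport fun x => 2 * φ x * fderiv ℝ φ x e * L x :=
    hφ.hasCompactSupport.mul_left.mul_right.mul_right
  exact h1.integrable_of_hasCompactSupport h2

/-- Integration by parts in direction `e`, writing the factor 1 as the derivative of `L`. -/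
theorem IsTestFunction.integral_sq_eq {Ω : Set (Rd d)} {φ : Rd d → ℝ}
    (hφ : IsTestFunction Ω φ) {e : Rd d} {L : Rd d →L[ℝ] ℝ} (hLe : L e = 1) :
    ∫ x, φ x ^ 2 = - ∫ x, 2 * φ x * fderiv ℝ φ x e * L x := by
  have hdiff : Differentiable ℝ φ := hφ.smooth.differentiable (by simp)
  have hsq : ∀ x, fderiv ℝ (fun x => φ x ^ 2) x e = 2 * φ x * fderiv ℝ φ x e := by
    intro x
    rw [fderiv_fun_pow _ (hdiff x)]
    simp
  have hL : ∀ x, fderiv ℝ L x e = 1 := fun x => by rw [L.fderiv, hLe]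
  have h1 : Integrable fun x => fderiv ℝ (fun x => φ x ^ 2) x e * L x := by
    simp only [hsq]
    exact hφ.integrable_mul_fderiv_mul e L
  have h2 : Integrable fun x => φ x ^ 2 * fderiv ℝ L x e := by
    simp only [hL, mul_one]
    exact hφ.integrable_sq
  have h3 : Integrable fun x => φ x ^ 2 * L x := by
    have hcs : HasCompactSupport fun x => φ x ^ 2 :=
      hφ.hasCompactSupport.comp_left (g := fun t => t ^ 2) (by simp)
    exact ((hφ.smooth.continuous.pow 2).mul L.continuous).integrable_of_hasCompactSupport
      hcs.mul_right
  have := integral_mul_fderiv_eq_neg_fderiv_mul_of_integrable h1 h2 h3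
    (fun x _ => (hdiff x).fun_pow 2) (fun x _ => L.differentiableAt)
  simpa only [hL, mul_one, hsq] using this

/-- The Poincaré inequality for test functions. -/
theorem IsTestFunction.integral_sq_le (hd : 1 ≤ d) {Ω : Set (Rd d)} {φ : Rd d → ℝ}
    (hφ : IsTestFunction Ω φ) {R : ℝ} (hR : Ω ⊆ Metric.closedBall 0 R) :
    ∫ x, φ x ^ 2 ≤ 4 * R ^ 2 * ∫ x, ‖gradient φ x‖ ^ 2 := by
  obtain ⟨e, he⟩ : ∃ e : Rd d, ‖e‖ = 1 := ⟨EuclideanSpace.single ⟨0, hd⟩ 1, by simp⟩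
  obtain ⟨L, hL⟩ : ∃ L : Rd d →L[ℝ] ℝ, ∀ x, L x = inner ℝ e x := ⟨innerSL ℝ e, fun _ => rfl⟩
  have hLe : L e = 1 := by rw [hL, real_inner_self_eq_norm_sq, he, one_pow]
  -- Young's inequality, weighted so that half of `φ x ^ 2` can be absorbed on the left; on the
  -- support, `|L x| ≤ R`.
  have hpt : ∀ x, -(2 * φ x * fderiv ℝ φ x e * L x) ≤
      1 / 2 * φ x ^ 2 + 2 * R ^ 2 * ‖gradient φ x‖ ^ 2 := by
    intro x
    by_cases hx : x ∈ tsupport φ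
    · have hxR : ‖x‖ ≤ R := by simpa using hR (hφ.tsupport_subset hx)
      have h1 : |L x| ≤ R := by
        calc |L x| = |inner ℝ e x| := by rw [hL]
          _ ≤ ‖e‖ * ‖x‖ := abs_real_inner_le_norm _ _
          _ ≤ R := by rwa [he, one_mul]
      have h2 : |fderiv ℝ φ x e| ≤ ‖gradient φ x‖ := by
        have : fderiv ℝ φ x e = inner ℝ (gradient φ x) e := by
          rw [gradient, InnerProductSpace.toDual_symm_apply]
        rw [this]
        exact (abs_real_inner_le_norm _ _).trans (by rw [he, mul_one])
      have h3 : |fderiv ℝ φ x e * L x| ≤ R * ‖gradient φ x‖ := by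
        rw [abs_mul, mul_comm R]
        gcongr
      have h4 : (fderiv ℝ φ x e * L x) ^ 2 ≤ (R * ‖gradient φ x‖) ^ 2 := sq_le_sq.2
        (h3.trans (le_abs_self _))
      nlinarith [sq_nonneg (φ x + 2 * (fderiv ℝ φ x e * L x))]
    · rw [image_eq_zero_of_notMem_tsupport hx]
      simp only [mul_zero, zero_mul, neg_zero]
      positivity
  have hi1 := hφ.integrable_sq
  have hi2 := hφ.integrable_norm_gradient_sq
  have h : ∫ x, -(2 * φ x * fderiv ℝ φ x e * L x) ≤
      ∫ x, (1 / 2 * φ x ^ 2 + 2 * R ^ 2 * ‖gradient φ x‖ ^ 2) :=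
    integral_mono (hφ.integrable_mul_fderiv_mul e L).neg
      ((hi1.const_mul (1 / 2)).add (hi2.const_mul (2 * R ^ 2))) hpt
  rw [integral_neg, ← hφ.integral_sq_eq hLe, integral_add (hi1.const_mul _) (hi2.const_mul _),
    integral_const_mul, integral_const_mul] at h
  linarith

theorem exists_isCoercivityConstant (hd : 1 ≤ d) {Ω : Set (Rd d)}
    (hbdd : Bornology.IsBounded Ω) : ∃ c : ℝ, IsCoercivityConstant Ω c := by
  obtain ⟨R, hR⟩ := hbdd.subset_closedBall 0
  have hsq : ∀ w : Pair Ω, ‖w‖ ^ 2 = ‖w.fst‖ ^ 2 + ‖w.snd‖ ^ 2 :=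
    fun w => WithLp.prod_norm_sq_eq_of_L2 w
  have key : ∀ w ∈ H10 Ω, ‖w.fst‖ ^ 2 ≤ 4 * R ^ 2 * ‖w.snd‖ ^ 2 := by
    have hcl : IsClosed {w : Pair Ω | ‖w.fst‖ ^ 2 ≤ 4 * R ^ 2 * ‖w.snd‖ ^ 2} :=
      isClosed_le (((WithLp.fstL 2 ℝ (L2 Ω) (L2Vec Ω)).continuous.norm).pow 2)
        (continuous_const.mul (((WithLp.sndL 2 ℝ (L2 Ω) (L2Vec Ω)).continuous.norm).pow 2))
    intro w hw
    refine closure_minimal (fun z hz => ?_) hcl hw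
    obtain ⟨φ, hφ, h1, h2⟩ := mem_testPairs_of_mem_span hz
    have e1 : ‖z.fst‖ ^ 2 = ∫ x, φ x ^ 2 := by
      rw [← real_inner_self_eq_norm_sq, L2.inner_def,
        ← setIntegral_eq_integral_of_forall_compl_eq_zero (s := Ω) (f := fun x => φ x ^ 2)]
      · refine integral_congr_ae ?_
        filter_upwards [h1] with x hx
        rw [real_inner_self_eq_norm_sq, hx, Real.norm_eq_abs, sq_abs]
      · intro x hx
        rw [image_eq_zero_of_notMem_tsupport fun h => hx (hφ.tsupport_subset h)]; simp
    have e2 : ‖z.snd‖ ^ 2 = ∫ x, ‖gradient φ x‖ ^ 2 := by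
      rw [← real_inner_self_eq_norm_sq, L2.inner_def,
        ← setIntegral_eq_integral_of_forall_compl_eq_zero (s := Ω)
          (f := fun x => ‖gradient φ x‖ ^ 2)]
      · refine integral_congr_ae ?_
        filter_upwards [h2] with x hx
        rw [real_inner_self_eq_norm_sq, hx]
      · intro x hx
        have : fderiv ℝ φ x = 0 := image_eq_zero_of_notMem_tsupport
          fun h => hx (hφ.tsupport_subset (tsupport_fderiv_subset ℝ h))
        simp [gradient, this]
    change ‖z.fst‖ ^ 2 ≤ 4 * R ^ 2 * ‖z.snd‖ ^ 2
    rw [e1, e2]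
    exact hφ.integral_sq_le hd hR
  refine ⟨(4 * R ^ 2 + 1)⁻¹, by positivity, fun v hv => ?_⟩
  rw [a, real_inner_self_eq_norm_sq, hsq, inv_mul_le_iff₀ (by positivity)]
  linarith [key v hv]

/-! ### Null faces and piecewise affine representatives -/

theorem volume_faceOpposite_closedInterior {n : ℕ} [NeZero n] (T : Affine.Simplex ℝ (Rd n) n)
    (i : Fin (n + 1)) : volume (T.faceOpposite i).closedInterior = 0 := by
  refine measure_mono_null (T.faceOpposite i).closedInterior_subset_affineSpan
    (Measure.addHaar_affineSubspace _ _ fun h => ?_)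
  have h1 := (T.faceOpposite i).independent.finrank_vectorSpan (Fintype.card_fin _)
  rw [← direction_affineSpan, h, AffineSubspace.direction_top, finrank_top] at h1
  have := NeZero.pos n
  simp at h1
  omega

theorem Mesh.ae_exists_mem_closedInterior {Ω : Set (Rd d)} (𝒯 : Mesh Ω) (hΩ : IsOpen Ω) :
    ∀ᵐ x ∂volume.restrict Ω, ∃ T ∈ 𝒯.cells, x ∈ T.closedInterior := by
  filter_upwards [ae_restrict_mem hΩ.measurableSet] with x hx
  have := 𝒯.closure_eq ▸ subset_closure hx
  simpa using this

theorem Mesh.ae_mem_interior [NeZero d] {Ω : Set (Rd d)} (𝒯 : Mesh Ω) :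
    ∀ᵐ x ∂volume, ∀ T ∈ 𝒯.cells, x ∈ T.closedInterior → x ∈ T.interior := by
  refine (Filter.eventually_all_finset 𝒯.cells).2 ?_
  intro T _
  have h : ∀ i, ∀ᵐ x ∂volume, x ∉ (T.faceOpposite i).closedInterior := fun i =>
    measure_eq_zero_iff_ae_notMem.1 (volume_faceOpposite_closedInterior T i)
  filter_upwards [ae_all_iff.2 h] with x hx hxT
  rw [T.closedInterior_eq_interior_union] at hxT
  refine hxT.resolve_right fun h' => ?_
  obtain ⟨i, hi⟩ := mem_iUnion.1 h'
  exact hx i hi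

theorem exists_affine_of_mem_Vh [NeZero d] {Ω : Set (Rd d)} {𝒯 : Mesh Ω} {w : Pair Ω}
    (hw : w ∈ Vh 𝒯) : ∃ ℓ : Affine.Simplex ℝ (Rd d) d → (Rd d →ᵃ[ℝ] ℝ),
      ∀ᵐ x ∂volume.restrict Ω, ∀ T ∈ 𝒯.cells, x ∈ T.closedInterior → w.fst x = ℓ T x := by
  have h := hw.2
  choose! ℓ hℓ using h
  refine ⟨ℓ, ?_⟩
  refine (Filter.eventually_all_finset 𝒯.cells).2 ?_
  intro T hT
  have hcl : T.interior =ᵐ[volume] T.closedInterior := by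
    filter_upwards [𝒯.ae_mem_interior] with x hx
    exact propext ⟨fun h => T.interior_subset_closedInterior h, hx T hT⟩
  have h1 := hℓ T hT
  rw [Filter.EventuallyEq, Measure.restrict_congr_set hcl,
    ae_restrict_iff' T.isClosed_closedInterior.measurableSet] at h1
  exact ae_restrict_of_ae h1

theorem isFiniteMeasure_restrict_of_isBounded {Ω : Set (Rd d)} (hbdd : Bornology.IsBounded Ω) :
    IsFiniteMeasure (volume.restrict Ω) :=
  isFiniteMeasure_restrict.2 hbdd.measure_lt_top.ne

theorem Mesh.ae_eq_of_mem_closedInterior [NeZero d] {Ω : Set (Rd d)} (𝒯 : Mesh Ω) :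
    ∀ᵐ x ∂volume.restrict Ω, ∀ T ∈ 𝒯.cells, ∀ T' ∈ 𝒯.cells,
      x ∈ T.closedInterior → x ∈ T'.closedInterior → T = T' := by
  filter_upwards [ae_restrict_of_ae 𝒯.ae_mem_interior] with x hx T hT T' hT' h h'
  by_contra hne
  exact Set.disjoint_left.1 (𝒯.disjoint T hT T' hT' hne) (hx T hT h) (hx T' hT' h')

/-! ### Finite dimension and quantitative bounds for discrete functions -/

/-- The functions underlying the elements of `V_h`. -/
def VhFst {Ω : Set (Rd d)} (𝒯 : Mesh Ω) : Submodule ℝ (L2 Ω) :=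
  (Vh 𝒯).map (WithLp.fstL 2 ℝ (L2 Ω) (L2Vec Ω)).toLinearMap

theorem mem_VhFst {Ω : Set (Rd d)} {𝒯 : Mesh Ω} {v : L2 Ω} :
    v ∈ VhFst 𝒯 ↔ ∃ w ∈ Vh 𝒯, w.fst = v := Iff.rfl

/-- The coefficients of discontinuous piecewise affine functions on a mesh. -/
abbrev PiecewiseAffineCoeff {Ω : Set (Rd d)} (𝒯 : Mesh Ω) : Type :=
  𝒯.cells → ℝ × (Rd d →ₗ[ℝ] ℝ)

/-- The piecewise affine function with given coefficients. -/
def piecewiseAffine {Ω : Set (Rd d)} (𝒯 : Mesh Ω) (f : PiecewiseAffineCoeff 𝒯) (x : Rd d) : ℝ :=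
  ∑ T : 𝒯.cells, T.1.closedInterior.indicator (fun x => (f T).1 + (f T).2 x) x

theorem memLp_piecewiseAffine {Ω : Set (Rd d)} (hbdd : Bornology.IsBounded Ω) (𝒯 : Mesh Ω)
    (f : PiecewiseAffineCoeff 𝒯) : MemLp (piecewiseAffine 𝒯 f) 2 (volume.restrict Ω) := by
  have := isFiniteMeasure_restrict_of_isBounded hbdd
  refine memLp_finsetSum _ fun T _ => ?_
  have hc : Continuous fun x => (f T).1 + (f T).2 x :=
    continuous_const.add (f T).2.continuous_of_finiteDimensional
  obtain ⟨C, hC⟩ := T.1.isCompact_closedInterior.exists_bound_of_continuousOn hc.continuousOn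
  refine MemLp.of_bound ?_ (max C 0) (Filter.Eventually.of_forall fun x => ?_)
  · exact (hc.measurable.indicator
      T.1.isClosed_closedInterior.measurableSet).aestronglyMeasurable
  · by_cases hx : x ∈ T.1.closedInterior
    · rw [indicator_of_mem hx]
      exact (hC x hx).trans (le_max_left _ _)
    · rw [indicator_of_notMem hx, norm_zero]
      exact le_max_right _ _

/-- The linear map that sends coefficients to the class of a piecewise affine function. -/
def piecewiseAffineL2 {Ω : Set (Rd d)} (hbdd : Bornology.IsBounded Ω) (𝒯 : Mesh Ω) :
    PiecewiseAffineCoeff 𝒯 →ₗ[ℝ] L2 Ω where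
  toFun f := (memLp_piecewiseAffine hbdd 𝒯 f).toLp _
  map_add' f g := by
    rw [← MemLp.toLp_add]
    refine MemLp.toLp_congr _ _ (Filter.Eventually.of_forall fun x => ?_)
    simp only [piecewiseAffine, Pi.add_apply, ← Finset.sum_add_distrib]
    refine Finset.sum_congr rfl fun T _ => ?_
    by_cases hx : x ∈ T.1.closedInterior
    · simp only [indicator_of_mem hx, Prod.fst_add, Prod.snd_add, LinearMap.add_apply]
      ring
    · simp only [indicator_of_notMem hx, add_zero]
  map_smul' c f := by
    rw [RingHom.id_apply, ← MemLp.toLp_const_smul]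
    refine MemLp.toLp_congr _ _ (Filter.Eventually.of_forall fun x => ?_)
    simp only [piecewiseAffine, Pi.smul_apply, Finset.smul_sum, ← Set.indicator_const_smul_apply]
    refine Finset.sum_congr rfl fun T _ => ?_
    congr 1
    ext y
    simp
    ring

/-- Finitely many coefficients determine a piecewise affine function: the cells cover almost every
point of `Ω` exactly once, so the sum over cells has a single nonzero term there. -/
theorem finiteDimensional_VhFst [NeZero d] {Ω : Set (Rd d)} (hΩ : IsOpen Ω)
    (hbdd : Bornology.IsBounded Ω) (𝒯 : Mesh Ω) : FiniteDimensional ℝ (VhFst 𝒯) := by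
  have hle : VhFst 𝒯 ≤ LinearMap.range (piecewiseAffineL2 hbdd 𝒯) := by
    rintro _ ⟨w, hw, rfl⟩
    obtain ⟨ℓ, hℓ⟩ := exists_affine_of_mem_Vh hw
    refine ⟨fun T => (ℓ T.1 0, (ℓ T.1).linear), ?_⟩
    refine Lp.ext ?_
    filter_upwards [hℓ, (memLp_piecewiseAffine hbdd 𝒯
      fun T => (ℓ T.1 0, (ℓ T.1).linear)).coeFn_toLp, 𝒯.ae_eq_of_mem_closedInterior,
      𝒯.ae_exists_mem_closedInterior hΩ] with x h1 h2 h3 h4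
    obtain ⟨T, hT, hx⟩ := h4
    refine h2.trans (Eq.trans ?_ (h1 T hT hx).symm)
    rw [piecewiseAffine, Finset.sum_eq_single ⟨T, hT⟩]
    · rw [indicator_of_mem hx]
      have := (ℓ T).map_vadd 0 x
      simp only [vadd_eq_add, add_zero] at this
      rw [this, add_comm]
    · intro T' _ hne
      refine indicator_of_notMem (fun hx' => hne (Subtype.ext ?_)) _
      exact h3 _ T'.2 _ hT hx' hx
    · exact fun h => absurd (Finset.mem_univ _) h
  exact Submodule.finiteDimensional_of_le hle

/-- Essentially bounded functions. -/
def IsEssBounded {Ω : Set (Rd d)} (v : L2 Ω) : Prop :=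
  ∃ M : ℝ, 0 < M ∧ ∀ᵐ x ∂volume.restrict Ω, |v x| ≤ M

/-- Functions whose small nonzero values are attained on small sets. -/
def HasThinSublevels {Ω : Set (Rd d)} (v : L2 Ω) : Prop :=
  ∃ K : ℝ, 0 ≤ K ∧ ∀ ε > 0, (volume.restrict Ω).real {x | 0 < |v x| ∧ |v x| ≤ ε} ≤ K * ε

theorem isEssBounded_of_mem_VhFst [NeZero d] {Ω : Set (Rd d)} (hΩ : IsOpen Ω) {𝒯 : Mesh Ω}
    {v : L2 Ω} (hv : v ∈ VhFst 𝒯) : IsEssBounded v := by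
  obtain ⟨w, hw, rfl⟩ := hv
  obtain ⟨ℓ, hℓ⟩ := exists_affine_of_mem_Vh hw
  have hb : ∀ T : Affine.Simplex ℝ (Rd d) d, ∃ C : ℝ, 0 ≤ C ∧ ∀ x ∈ T.closedInterior,
      |ℓ T x| ≤ C := by
    intro T
    obtain ⟨C, hC⟩ := T.isCompact_closedInterior.exists_bound_of_continuousOn
      (ℓ T).continuous_of_finiteDimensional.continuousOn
    exact ⟨max C 0, le_max_right _ _, fun x hx => (hC x hx).trans (le_max_left _ _)⟩
  choose C hC0 hC using hb
  refine ⟨∑ T ∈ 𝒯.cells, C T + 1, by linarith [Finset.sum_nonneg fun T (_ : T ∈ 𝒯.cells) => hC0 T],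
    ?_⟩
  filter_upwards [hℓ, 𝒯.ae_exists_mem_closedInterior hΩ] with x h1 ⟨T, hT, hx⟩
  change |w.fst x| ≤ _
  rw [h1 T hT hx]
  linarith [hC T x hx, Finset.single_le_sum (fun T _ => hC0 T) hT]

/-- The affine slab estimate summed over cells. Excluding the value zero is essential, since a
discrete function may vanish on whole cells. -/
theorem hasThinSublevels_of_mem_VhFst [NeZero d] {Ω : Set (Rd d)} (hΩ : IsOpen Ω) {𝒯 : Mesh Ω}
    {v : L2 Ω} (hv : v ∈ VhFst 𝒯) : HasThinSublevels v := by
  obtain ⟨w, hw, rfl⟩ := hv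
  obtain ⟨ℓ, hℓ⟩ := exists_affine_of_mem_Vh hw
  have hb := fun T : Affine.Simplex ℝ (Rd d) d =>
    exists_measureReal_sublevel_le (ℓ T) T.isCompact_closedInterior.isBounded
  choose K hK0 hK using hb
  refine ⟨∑ T ∈ 𝒯.cells, K T, Finset.sum_nonneg fun T _ => hK0 T, fun ε hε => ?_⟩
  let S : Affine.Simplex ℝ (Rd d) d → Set (Rd d) :=
    fun T => {x | x ∈ T.closedInterior ∧ 0 < |ℓ T x| ∧ |ℓ T x| ≤ ε}
  have hSfin : ∀ T, volume (S T) ≠ ⊤ := fun T =>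
    ((measure_mono fun x hx => hx.1).trans_lt T.isCompact_closedInterior.measure_lt_top).ne
  have hle : volume.restrict Ω {x | 0 < |w.fst x| ∧ |w.fst x| ≤ ε} ≤
      volume (⋃ T ∈ 𝒯.cells, S T) := by
    refine (measure_mono_ae ?_).trans (Measure.restrict_apply_le Ω _)
    filter_upwards [hℓ, 𝒯.ae_exists_mem_closedInterior hΩ] with x h1 ⟨T, hT, hx⟩ h
    have h' : 0 < |w.fst x| ∧ |w.fst x| ≤ ε := h
    rw [h1 T hT hx] at h'
    exact mem_biUnion hT ⟨hx, h'⟩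
  have hfin : volume (⋃ T ∈ 𝒯.cells, S T) ≠ ⊤ :=
    ((measure_biUnion_lt_top 𝒯.cells.finite_toSet fun T _ => (hSfin T).lt_top)).ne
  calc (volume.restrict Ω).real {x | 0 < |w.fst x| ∧ |w.fst x| ≤ ε}
      ≤ volume.real (⋃ T ∈ 𝒯.cells, S T) := ENNReal.toReal_mono hfin hle
    _ ≤ ∑ T ∈ 𝒯.cells, volume.real (S T) := measureReal_biUnion_finset_le _ _
    _ ≤ ∑ T ∈ 𝒯.cells, K T * ε := Finset.sum_le_sum fun T _ => hK T ε hε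
    _ = (∑ T ∈ 𝒯.cells, K T) * ε := (Finset.sum_mul _ _ _).symm

/-- In a finite-dimensional space of bounded functions, the maximum norm is bounded by the `L²`
norm. -/
theorem exists_ae_abs_le_mul_norm {Ω : Set (Rd d)} (U : Submodule ℝ (L2 Ω))
    [FiniteDimensional ℝ U] (hU : ∀ v ∈ U, IsEssBounded v) :
    ∃ C : ℝ, 0 ≤ C ∧ ∀ v ∈ U, ∀ᵐ x ∂volume.restrict Ω, |v x| ≤ C * ‖v‖ := by
  let b := stdOrthonormalBasis ℝ U
  choose M hM0 hM using fun i => hU (b i) (b i).2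
  refine ⟨∑ i, M i, Finset.sum_nonneg fun i _ => (hM0 i).le, fun v hv => ?_⟩
  have hsum : v = ∑ i, inner ℝ (b i : L2 Ω) v • (b i : L2 Ω) := by
    have := congrArg Subtype.val (b.sum_repr' ⟨v, hv⟩)
    simpa using this.symm
  have hcoe : ∀ᵐ x ∂volume.restrict Ω, v x = ∑ i, inner ℝ (b i : L2 Ω) v * (b i : L2 Ω) x := by
    have h1 : ∀ᵐ x ∂volume.restrict Ω, ∀ i,
        (inner ℝ (b i : L2 Ω) v • (b i : L2 Ω) : L2 Ω) x = inner ℝ (b i : L2 Ω) v * (b i : L2 Ω) x :=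
      ae_all_iff.2 fun i => Lp.coeFn_smul _ _
    have h2 := Lp.coeFn_finsetSum Finset.univ
      (fun i => (inner ℝ (b i : L2 Ω) v • (b i : L2 Ω) : L2 Ω))
    rw [← hsum] at h2
    filter_upwards [h1, h2] with x h1 h2
    rw [h2, Finset.sum_apply]
    exact Finset.sum_congr rfl fun i _ => h1 i
  filter_upwards [hcoe, ae_all_iff.2 hM] with x hx hMx
  rw [hx, Finset.sum_mul]
  refine (Finset.abs_sum_le_sum_abs _ _).trans (Finset.sum_le_sum fun i _ => ?_)
  rw [abs_mul, mul_comm]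
  refine mul_le_mul (hMx i) ?_ (abs_nonneg _) (hM0 i).le
  have h1 : ‖(b i : L2 Ω)‖ = 1 := b.norm_eq_one i
  exact (abs_real_inner_le_norm _ _).trans (by rw [h1, one_mul])

/-! ### Integrated calculus of the L¹ norm -/

theorem L2_inner_eq_integral {Ω : Set (Rd d)} (u v : L2 Ω) :
    inner ℝ u v = ∫ x in Ω, u x * v x := by
  rw [L2.inner_def]
  simp [mul_comm]

theorem integrable_L2_mul {Ω : Set (Rd d)} (u v : L2 Ω) :
    Integrable (fun x => u x * v x) (volume.restrict Ω) :=
  (Lp.memLp u).integrable_mul (Lp.memLp v)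

theorem integrable_L2 {Ω : Set (Rd d)} [IsFiniteMeasure (volume.restrict Ω)] (v : L2 Ω) :
    Integrable v (volume.restrict Ω) :=
  (Lp.memLp v).integrable (by norm_num)

theorem normL1_sub_normL1 {Ω : Set (Rd d)} [IsFiniteMeasure (volume.restrict Ω)] (u v : L2 Ω) :
    normL1 u - normL1 v = ∫ x in Ω, (|u x| - |v x|) :=
  (integral_sub (integrable_L2 u).abs (integrable_L2 v).abs).symm

theorem aemeasurable_pair {Ω : Set (Rd d)} (y z : L2 Ω) :
    AEMeasurable (fun x => (y x, z x)) (volume.restrict Ω) :=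
  (Lp.aestronglyMeasurable y).aemeasurable.prodMk (Lp.aestronglyMeasurable z).aemeasurable

theorem integrable_absDeriv {Ω : Set (Rd d)} [IsFiniteMeasure (volume.restrict Ω)] (y z : L2 Ω) :
    Integrable (fun x => absDeriv (y x) (z x)) (volume.restrict Ω) := by
  refine (integrable_L2 z).mono
    (measurable_absDeriv.comp_aemeasurable (aemeasurable_pair y z)).aestronglyMeasurable
    (Filter.Eventually.of_forall fun x => ?_)
  rw [Real.norm_eq_abs, Real.norm_eq_abs, ← absSubgrad_mul_self, abs_mul]
  exact mul_le_of_le_one_left (abs_nonneg _) (abs_absSubgrad_le _ _)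

theorem memLp_absSubgrad {Ω : Set (Rd d)} [IsFiniteMeasure (volume.restrict Ω)] (y z : L2 Ω) :
    MemLp (fun x => absSubgrad (y x) (z x)) 2 (volume.restrict Ω) :=
  MemLp.of_bound
    (measurable_absSubgrad.comp_aemeasurable (aemeasurable_pair y z)).aestronglyMeasurable 1
    (Filter.Eventually.of_forall fun _ => abs_absSubgrad_le _ _)

theorem memLp_sgnJump {Ω : Set (Rd d)} [IsFiniteMeasure (volume.restrict Ω)] (y z : L2 Ω) :
    MemLp (fun x => sgnJump (y x) (z x)) 2 (volume.restrict Ω) :=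
  MemLp.of_bound
    (measurable_sgnJump.comp_aemeasurable (aemeasurable_pair y z)).aestronglyMeasurable 2
    (Filter.Eventually.of_forall fun _ => abs_sgnJump_le _ _)

/-- The subgradient `absSubgrad y z` as an element of `L²(Ω)`. -/
def subgradL2 {Ω : Set (Rd d)} [IsFiniteMeasure (volume.restrict Ω)] (y z : L2 Ω) : L2 Ω :=
  (memLp_absSubgrad y z).toLp _

/-- The sign change `sgnJump y z` as an element of `L²(Ω)`. -/
def jumpL2 {Ω : Set (Rd d)} [IsFiniteMeasure (volume.restrict Ω)] (y z : L2 Ω) : L2 Ω :=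
  (memLp_sgnJump y z).toLp _

theorem coeFn_subgradL2 {Ω : Set (Rd d)} [IsFiniteMeasure (volume.restrict Ω)] (y z : L2 Ω) :
    ∀ᵐ x ∂volume.restrict Ω, subgradL2 y z x = absSubgrad (y x) (z x) :=
  (memLp_absSubgrad y z).coeFn_toLp

theorem coeFn_jumpL2 {Ω : Set (Rd d)} [IsFiniteMeasure (volume.restrict Ω)] (y z : L2 Ω) :
    ∀ᵐ x ∂volume.restrict Ω, jumpL2 y z x = sgnJump (y x) (z x) :=
  (memLp_sgnJump y z).coeFn_toLp

theorem inner_subgradL2_self {Ω : Set (Rd d)} [IsFiniteMeasure (volume.restrict Ω)]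
    (y z : L2 Ω) : inner ℝ (subgradL2 y z) z = ∫ x in Ω, absDeriv (y x) (z x) := by
  rw [L2_inner_eq_integral]
  refine integral_congr_ae ?_
  filter_upwards [coeFn_subgradL2 y z] with x hx
  rw [hx, absSubgrad_mul_self]

theorem inner_subgradL2_sub_le {Ω : Set (Rd d)} [IsFiniteMeasure (volume.restrict Ω)]
    (y z v : L2 Ω) : inner ℝ (subgradL2 y z) (v - y) ≤ normL1 v - normL1 y := by
  rw [L2_inner_eq_integral, normL1_sub_normL1]
  refine integral_mono_ae (integrable_L2_mul _ _)
    ((integrable_L2 v).abs.sub (integrable_L2 y).abs) ?_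
  filter_upwards [coeFn_subgradL2 y z, Lp.coeFn_sub v y] with x h1 h2
  rw [h1, h2]
  exact absSubgrad_mul_sub_le _ _ _

theorem inner_jumpL2_self_nonneg {Ω : Set (Rd d)} [IsFiniteMeasure (volume.restrict Ω)]
    (y z : L2 Ω) : 0 ≤ inner ℝ (jumpL2 y z) z := by
  rw [L2_inner_eq_integral]
  refine integral_nonneg_of_ae ?_
  filter_upwards [coeFn_jumpL2 y z] with x hx
  rw [hx]
  exact sgnJump_mul_nonneg _ _

theorem normL1_add_sub_le {Ω : Set (Rd d)} [IsFiniteMeasure (volume.restrict Ω)] (y z : L2 Ω) :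
    normL1 (y + z) - normL1 y ≤
      (∫ x in Ω, absDeriv (y x) (z x)) + inner ℝ (jumpL2 y z) z := by
  rw [L2_inner_eq_integral, normL1_sub_normL1,
    ← integral_add (integrable_absDeriv y z) (integrable_L2_mul _ _)]
  refine integral_mono_ae ((integrable_L2 _).abs.sub (integrable_L2 y).abs)
    ((integrable_absDeriv y z).add (integrable_L2_mul _ _)) ?_
  filter_upwards [coeFn_jumpL2 y z, Lp.coeFn_add y z] with x h1 h2
  rw [h1, h2]
  exact abs_add_sub_abs_le _ _

theorem integral_absDeriv_add_inner_jumpL2_le {Ω : Set (Rd d)}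
    [IsFiniteMeasure (volume.restrict Ω)] (y z v : L2 Ω) :
    (∫ x in Ω, absDeriv (y x) (v x)) - normL1 y - (∫ x in Ω, absDeriv (y x) (z x)) +
      inner ℝ (jumpL2 y z) (v - (y + z)) ≤ normL1 v - normL1 (y + z) := by
  have h1 : Integrable (fun x => absDeriv (y x) (v x) - |y x|) (volume.restrict Ω) :=
    (integrable_absDeriv y v).sub (integrable_L2 y).abs
  have h2 : Integrable (fun x => absDeriv (y x) (v x) - |y x| - absDeriv (y x) (z x))
      (volume.restrict Ω) := h1.sub (integrable_absDeriv y z)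
  rw [L2_inner_eq_integral, normL1_sub_normL1, normL1,
    ← integral_sub (integrable_absDeriv y v) (integrable_L2 y).abs,
    ← integral_sub h1 (integrable_absDeriv y z), ← integral_add h2 (integrable_L2_mul _ _)]
  refine integral_mono_ae (h2.add (integrable_L2_mul _ _))
    ((integrable_L2 _).abs.sub (integrable_L2 _).abs) ?_
  filter_upwards [coeFn_jumpL2 y z, Lp.coeFn_add y z, Lp.coeFn_sub v (y + z)] with x h1 h2 h3
  rw [h1, h3, Pi.sub_apply, h2]
  exact absDeriv_add_sgnJump_le _ _ _

theorem integral_absDeriv_smul {Ω : Set (Rd d)} (y z : L2 Ω) {t : ℝ} (ht : 0 ≤ t) :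
    ∫ x in Ω, absDeriv (y x) ((t • z : L2 Ω) x) = t * ∫ x in Ω, absDeriv (y x) (z x) := by
  rw [← integral_const_mul]
  refine integral_congr_ae ?_
  filter_upwards [Lp.coeFn_smul t z] with x hx
  rw [hx, Pi.smul_apply, smul_eq_mul, absDeriv_smul _ _ ht]

theorem integral_absDeriv_neg_self {Ω : Set (Rd d)} (y : L2 Ω) :
    ∫ x in Ω, absDeriv (y x) ((-y : L2 Ω) x) = -normL1 y := by
  rw [normL1, ← integral_neg]
  refine integral_congr_ae ?_
  filter_upwards [Lp.coeFn_neg y] with x hx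
  rw [hx, Pi.neg_apply, absDeriv_neg_self]

/-- Pairing with the sign change is controlled by the size of the step. -/
theorem exists_inner_jumpL2_le {Ω : Set (Rd d)} [IsFiniteMeasure (volume.restrict Ω)]
    {y z : L2 Ω} (hy : HasThinSublevels y) (hz : IsEssBounded z) :
    ∃ C : ℝ, 0 ≤ C ∧ ∀ t > 0, ∀ (v : L2 Ω) (M : ℝ), (∀ᵐ x ∂volume.restrict Ω, |v x| ≤ M) →
      0 ≤ M → inner ℝ (jumpL2 y (t • z)) v ≤ C * t * M := by
  obtain ⟨K, hK0, hK⟩ := hy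
  obtain ⟨B, hB0, hB⟩ := hz
  refine ⟨2 * K * B, by positivity, fun t ht v M hv hM => ?_⟩
  -- Almost everywhere outside `S` the jump vanishes. The estimate pairs it with a bounded `v`,
  -- hence is linear in the measure of `S` and so in `t`.
  let S : Set (Rd d) := {x | 0 < |y x| ∧ |y x| ≤ t * B}
  have hSm : MeasurableSet S := by
    have h := (Lp.stronglyMeasurable y).measurable.abs
    exact (measurableSet_lt measurable_const h).inter (measurableSet_le h measurable_const)
  have hint : Integrable (S.indicator fun _ => 2 * M) (volume.restrict Ω) :=
    (integrable_const _).indicator hSm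
  rw [L2_inner_eq_integral]
  calc ∫ x in Ω, jumpL2 y (t • z) x * v x ≤ ∫ x in Ω, S.indicator (fun _ => 2 * M) x := by
        refine integral_mono_ae (integrable_L2_mul _ _) hint ?_
        filter_upwards [coeFn_jumpL2 y (t • z), Lp.coeFn_smul t z, hv, hB] with x h1 h2 h3 h4
        rw [h1, h2, Pi.smul_apply, smul_eq_mul]
        by_cases hx : x ∈ S
        · rw [indicator_of_mem hx]
          refine (le_abs_self _).trans ?_
          rw [abs_mul]
          exact mul_le_mul (abs_sgnJump_le _ _) h3 (abs_nonneg _) zero_le_two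
        · rw [indicator_of_notMem hx, sgnJump_eq_zero, zero_mul]
          rintro ⟨h5, h6⟩
          refine hx ⟨h5, h6.trans ?_⟩
          rw [abs_mul, abs_of_pos ht]
          gcongr
    _ = (volume.restrict Ω).real S * (2 * M) := by
        rw [integral_indicator hSm, setIntegral_const, smul_eq_mul]
    _ ≤ K * (t * B) * (2 * M) := by
        gcongr
        exact hK _ (by positivity)
    _ = 2 * K * B * t * M := by ring

/-! ### Representation of the form on the discrete space, and the residual -/

theorem eq_zero_of_fst_eq_zero {Ω : Set (Rd d)} (hΩ : IsOpen Ω) {w : Pair Ω} (hw : w ∈ H10 Ω)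
    (h : w.fst = 0) : w = 0 := by
  have h1 := isWeakGradient_of_mem_H10 hw
  have h0 := isWeakGradient_of_mem_H10 (H10 Ω).zero_mem
  rw [h] at h1
  have h2 : w.snd = (0 : Pair Ω).snd := h1.unique hΩ h0
  exact WithLp.ofLp_injective 2 (Prod.ext h h2)

/-- On `V_h`, the form `a(y, ·)` is represented by an element of `L²(Ω)`. -/
theorem exists_inner_eq_a [NeZero d] {Ω : Set (Rd d)} (hΩ : IsOpen Ω)
    (hbdd : Bornology.IsBounded Ω) (𝒯 : Mesh Ω) (y : Pair Ω) :
    ∃ h : L2 Ω, ∀ z ∈ Vh 𝒯, inner ℝ h z.fst = a y z := by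
  let f : Vh 𝒯 →ₗ[ℝ] L2 Ω := (WithLp.fstL 2 ℝ (L2 Ω) (L2Vec Ω)).toLinearMap.domRestrict (Vh 𝒯)
  have hf : Function.Injective f := by
    refine (injective_iff_map_eq_zero f).2 fun w hw => Subtype.ext ?_
    exact eq_zero_of_fst_eq_zero hΩ w.2.1 hw
  have hrange : LinearMap.range f = VhFst 𝒯 := LinearMap.range_domRestrict _ _
  have hfin : FiniteDimensional ℝ (LinearMap.range f) := by
    rw [hrange]
    exact finiteDimensional_VhFst hΩ hbdd 𝒯
  let e : Vh 𝒯 ≃ₗ[ℝ] LinearMap.range f := LinearEquiv.ofInjective f hf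
  let g : Vh 𝒯 →ₗ[ℝ] ℝ :=
    ((innerSL ℝ y.snd).comp (WithLp.sndL 2 ℝ (L2 Ω) (L2Vec Ω))).toLinearMap.domRestrict (Vh 𝒯)
  let φ : StrongDual ℝ (LinearMap.range f) :=
    LinearMap.toContinuousLinearMap (g.comp e.symm.toLinearMap)
  -- A discrete function determines its gradient, so `a y` factors through the L² component; finite
  -- dimension makes the factor continuous and Riesz applies.
  let h := (InnerProductSpace.toDual ℝ (LinearMap.range f)).symm φ
  refine ⟨h, fun z hz => ?_⟩
  have h1 : inner ℝ h (e ⟨z, hz⟩) = φ (e ⟨z, hz⟩) := InnerProductSpace.toDual_symm_apply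
  have h2 : φ (e ⟨z, hz⟩) = g ⟨z, hz⟩ := by
    change g (e.symm (e ⟨z, hz⟩)) = _
    rw [e.symm_apply_apply]
  exact h1.trans h2

/-- The linear functional `z ↦ (u, z) - a(y, z)`. -/
def residual {Ω : Set (Rd d)} (y : Pair Ω) (u : L2 Ω) (z : Pair Ω) : ℝ :=
  inner ℝ u z.fst - a y z

theorem residual_add {Ω : Set (Rd d)} (y : Pair Ω) (u : L2 Ω) (z z' : Pair Ω) :
    residual y u (z + z') = residual y u z + residual y u z' := by
  simp only [residual, a, WithLp.add_fst, WithLp.add_snd, inner_add_right]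
  ring

theorem residual_smul {Ω : Set (Rd d)} (y : Pair Ω) (u : L2 Ω) (t : ℝ) (z : Pair Ω) :
    residual y u (t • z) = t * residual y u z := by
  simp only [residual, a, WithLp.smul_fst, WithLp.smul_snd, real_inner_smul_right]
  ring

theorem residual_add_left {Ω : Set (Rd d)} (y y' : Pair Ω) (u u' : L2 Ω) (z : Pair Ω) :
    residual (y + y') (u + u') z = residual y u z + residual y' u' z := by
  simp only [residual, a, WithLp.add_snd, inner_add_left]
  ring

theorem isFeasible_iff {Ω : Set (Rd d)} {𝒯 : Mesh Ω} {y : Pair Ω} {u : L2 Ω} :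
    IsFeasible 𝒯 y u ↔ y ∈ Vh 𝒯 ∧
      ∀ v ∈ Vh 𝒯, residual y u (v - y) ≤ normL1 v.fst - normL1 y.fst := by
  refine and_congr_right fun _ => forall₂_congr fun v _ => ?_
  rw [residual, sub_le_iff_le_add]
  constructor <;> intro h <;> linarith

/-! ### First order conditions at a local solution -/

/-- A first order condition along curves of feasible points. -/
theorem IsLocalSolution.first_order {Ω : Set (Rd d)} {𝒯 : Mesh Ω} {ν : ℝ} (hν : 0 < ν)
    {yd ud : L2 Ω} {ybar : Pair Ω} {ubar : L2 Ω} (hloc : IsLocalSolution 𝒯 ν yd ud ybar ubar)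
    (η : Pair Ω) (δ : ℝ → L2 Ω) {C κ : ℝ} (hC : 0 ≤ C)
    (hfeas : ∀ t, 0 < t → t ≤ 1 → IsFeasible 𝒯 (ybar + t • η) (ubar + δ t))
    (hδ : ∀ t, 0 < t → t ≤ 1 → ‖δ t‖ ≤ C * t)
    (hκ : ∀ t, 0 < t → t ≤ 1 → inner ℝ (ubar - ud) (δ t) ≤ t * κ) :
    0 ≤ inner ℝ (ybar.fst - yd) η.fst + ν * κ := by
  obtain ⟨_, ε, hε, hmin⟩ := hloc
  -- `X` bounds the slope of the objective from above and `D` its quadratic remainder. The curve `δ`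
  -- need not be differentiable: a bound O(t) makes its squared norm negligible.
  set X := inner ℝ (ybar.fst - yd) η.fst + ν * κ with hX
  set D := 1 / 2 * ‖η.fst‖ ^ 2 + ν / 2 * C ^ 2 with hD
  have hD0 : 0 ≤ D := by positivity
  have key : ∀ t, 0 < t → t ≤ 1 → t * (‖η‖ + C) ≤ ε → 0 ≤ X + t * D := by
    intro t ht ht1 hts
    have hη0 := norm_nonneg η
    have h1 : ‖(ybar + t • η) - ybar‖ ≤ ε := by
      rw [add_sub_cancel_left, norm_smul, Real.norm_of_nonneg ht.le]
      nlinarith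
    have h2 : ‖(ubar + δ t) - ubar‖ ≤ ε := by
      rw [add_sub_cancel_left]
      nlinarith [hδ t ht ht1]
    have h3 := hmin _ _ (hfeas t ht ht1) h1 h2
    have e1 : (ybar + t • η).fst - yd = (ybar.fst - yd) + t • η.fst := by
      rw [WithLp.add_fst, WithLp.smul_fst]; abel
    have e2 : ubar + δ t - ud = (ubar - ud) + δ t := by abel
    rw [J, J, e1, e2, norm_add_sq_real, norm_add_sq_real, real_inner_smul_right, norm_smul,
      Real.norm_of_nonneg ht.le] at h3
    have h4 : ‖δ t‖ ^ 2 ≤ (C * t) ^ 2 := by gcongr; exact hδ t ht ht1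
    have h5 := hκ t ht ht1
    have h6 : ν * inner ℝ (ubar - ud) (δ t) ≤ ν * (t * κ) := by gcongr
    have h7 : ν / 2 * ‖δ t‖ ^ 2 ≤ ν / 2 * (C * t) ^ 2 := by gcongr
    have h8 : 0 ≤ t * (X + t * D) := by
      rw [hX, hD]
      nlinarith
    exact nonneg_of_mul_nonneg_right h8 ht
  by_contra! hneg
  obtain ⟨t, ht, h1, h2, h3⟩ : ∃ t : ℝ, 0 < t ∧ t ≤ 1 ∧ t * (‖η‖ + C) ≤ ε ∧ t * D < -X := by
    have hs : 0 ≤ ‖η‖ + C := by positivity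
    refine ⟨min 1 (min (ε / (‖η‖ + C + 1)) (-X / (D + 1))), ?_, min_le_left _ _, ?_, ?_⟩
    · exact lt_min one_pos (lt_min (by positivity) (div_pos (by linarith) (by linarith)))
    · calc _ ≤ ε / (‖η‖ + C + 1) * (‖η‖ + C) := by
            gcongr; exact (min_le_right _ _).trans (min_le_left _ _)
        _ ≤ ε / (‖η‖ + C + 1) * (‖η‖ + C + 1) :=
            mul_le_mul_of_nonneg_left (by linarith) (by positivity)
        _ = ε := by field_simp
    · calc _ ≤ -X / (D + 1) * D := by
            gcongr; exact (min_le_right _ _).trans (min_le_right _ _)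
        _ < -X / (D + 1) * (D + 1) := by
            have : 0 < -X / (D + 1) := div_pos (by linarith) (by linarith)
            gcongr; linarith
        _ = -X := by field_simp
  linarith [key t ht h1 h2]

/-- The control misfit of a local solution belongs to the discrete space. -/
theorem IsLocalSolution.sub_mem_VhFst [NeZero d] {Ω : Set (Rd d)} (hΩ : IsOpen Ω)
    (hbdd : Bornology.IsBounded Ω) {𝒯 : Mesh Ω} {ν : ℝ} (hν : 0 < ν)
    {yd ud : L2 Ω} {ybar : Pair Ω} {ubar : L2 Ω} (hloc : IsLocalSolution 𝒯 ν yd ud ybar ubar) :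
    ubar - ud ∈ VhFst 𝒯 := by
  have := finiteDimensional_VhFst hΩ hbdd 𝒯
  have key : ∀ h ∈ (VhFst 𝒯)ᗮ, 0 ≤ inner ℝ (ubar - ud) h := by
    intro h hh
    have hf := isFeasible_iff.1 hloc.1
    have := hloc.first_order hν 0 (fun t => t • h) (C := ‖h‖) (κ := inner ℝ (ubar - ud) h)
      (norm_nonneg _) ?_ ?_ ?_
    · rw [WithLp.zero_fst, inner_zero_right, zero_add] at this
      exact nonneg_of_mul_nonneg_right this hν
    · intro t _ _
      rw [smul_zero, add_zero, isFeasible_iff]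
      refine ⟨hf.1, fun v hv => ?_⟩
      have h0 : inner ℝ h (v - ybar).fst = 0 :=
        Submodule.inner_left_of_mem_orthogonal (mem_VhFst.2 ⟨_, (Vh 𝒯).sub_mem hv hf.1, rfl⟩) hh
      have := hf.2 v hv
      rw [residual] at this ⊢
      rwa [inner_add_left, real_inner_smul_left, h0, mul_zero, add_zero]
    · intro t ht _
      rw [norm_smul, Real.norm_of_nonneg ht.le, mul_comm]
    · intro t _ _
      rw [real_inner_smul_right]
  -- Finite dimension makes the space equal to its double complement; testing with both `h` and `-h`
  -- turns the inequality into orthogonality.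
  rw [← Submodule.orthogonal_orthogonal (VhFst 𝒯), Submodule.mem_orthogonal']
  intro h hh
  have h1 := key h hh
  have h2 := key (-h) (Submodule.neg_mem _ hh)
  rw [inner_neg_right] at h2
  linarith

/-- The residual of a feasible point is bounded by the directional derivative of the `L¹` norm. -/
theorem IsFeasible.residual_le [NeZero d] {Ω : Set (Rd d)} (hΩ : IsOpen Ω)
    (hbdd : Bornology.IsBounded Ω) {𝒯 : Mesh Ω} {y : Pair Ω} {u : L2 Ω}
    (hf : IsFeasible 𝒯 y u) {z : Pair Ω} (hz : z ∈ Vh 𝒯) :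
    residual y u z ≤ ∫ x in Ω, absDeriv (y.fst x) (z.fst x) := by
  have := isFiniteMeasure_restrict_of_isBounded hbdd
  obtain ⟨hy, hf⟩ := isFeasible_iff.1 hf
  have hzb := isEssBounded_of_mem_VhFst hΩ (mem_VhFst.2 ⟨z, hz, rfl⟩)
  obtain ⟨C, hC0, hC⟩ := exists_inner_jumpL2_le
    (hasThinSublevels_of_mem_VhFst hΩ (mem_VhFst.2 ⟨y, hy, rfl⟩)) hzb
  obtain ⟨M, hM0, hM⟩ := hzb
  -- Test the variational inequality with `y + t • z` and divide by `t`; the jump contributes an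
  -- error that vanishes with `t`.
  have key : ∀ t > 0, residual y u z ≤
      (∫ x in Ω, absDeriv (y.fst x) (z.fst x)) + C * t * M := by
    intro t ht
    have h1 := hf (y + t • z) ((Vh 𝒯).add_mem hy ((Vh 𝒯).smul_mem t hz))
    rw [add_sub_cancel_left, residual_smul, WithLp.add_fst, WithLp.smul_fst] at h1
    have h2 := normL1_add_sub_le y.fst (t • z.fst)
    rw [integral_absDeriv_smul _ _ ht.le, real_inner_smul_right] at h2
    have h3 := mul_le_mul_of_nonneg_left (hC t ht z.fst M hM hM0.le) ht.le
    refine le_of_mul_le_mul_left ?_ ht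
    linarith
  refine le_of_forall_pos_le_add fun ε hε => ?_
  refine (key (ε / (C * M + 1)) (by positivity)).trans ?_
  gcongr
  calc C * (ε / (C * M + 1)) * M = ε / (C * M + 1) * (C * M) := by ring
    _ ≤ ε / (C * M + 1) * (C * M + 1) := by gcongr; linarith
    _ = ε := by field_simp

/-- The negative control misfit is a critical direction. -/
theorem IsLocalSolution.integral_absDeriv_le [NeZero d] {Ω : Set (Rd d)} (hΩ : IsOpen Ω)
    (hbdd : Bornology.IsBounded Ω) {𝒯 : Mesh Ω} {ν : ℝ} (hν : 0 < ν)
    {yd ud : L2 Ω} {ybar : Pair Ω} {ubar : L2 Ω} (hloc : IsLocalSolution 𝒯 ν yd ud ybar ubar)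
    {W : Pair Ω} (hW : W ∈ Vh 𝒯) (hWu : W.fst = -(ubar - ud)) :
    ∫ x in Ω, absDeriv (ybar.fst x) (W.fst x) ≤ residual ybar ubar W := by
  have := isFiniteMeasure_restrict_of_isBounded hbdd
  obtain ⟨hy, hf⟩ := isFeasible_iff.1 hloc.1
  obtain ⟨h, hh⟩ := exists_inner_eq_a hΩ hbdd 𝒯 ybar
  -- On discrete functions, adding `t • δ` to the control replaces the residual by its convex
  -- combination with the chosen subgradient, so `ybar` still solves the inequality.
  set δ : L2 Ω := subgradL2 ybar.fst W.fst - ubar + h with hδ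
  have hδz : ∀ z ∈ Vh 𝒯, inner ℝ δ z.fst =
      inner ℝ (subgradL2 ybar.fst W.fst) z.fst - residual ybar ubar z := by
    intro z hz
    rw [hδ, inner_add_left, inner_sub_left, hh z hz, residual]
    ring
  have := hloc.first_order hν 0 (fun t => t • δ) (C := ‖δ‖) (κ := inner ℝ (ubar - ud) δ)
      (norm_nonneg _) ?_ ?_ ?_
  · rw [WithLp.zero_fst, inner_zero_right, zero_add] at this
    have h1 := nonneg_of_mul_nonneg_right this hν
    have h2 := hδz W hW
    rw [inner_subgradL2_self] at h2
    have h3 : inner ℝ δ W.fst = -inner ℝ (ubar - ud) δ := by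
      rw [hWu, inner_neg_right, real_inner_comm]
    linarith
  · intro t ht ht1
    rw [smul_zero, add_zero, isFeasible_iff]
    refine ⟨hy, fun v hv => ?_⟩
    have hvy := (Vh 𝒯).sub_mem hv hy
    have h1 : residual ybar (ubar + t • δ) (v - ybar) = (1 - t) * residual ybar ubar (v - ybar) +
        t * inner ℝ (subgradL2 ybar.fst W.fst) (v - ybar).fst := by
      have h2 : residual ybar (ubar + t • δ) (v - ybar) =
          residual ybar ubar (v - ybar) + t * inner ℝ δ (v - ybar).fst := by
        rw [residual, residual, inner_add_left, real_inner_smul_left]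
        ring
      rw [h2, hδz _ hvy]
      ring
    have h3 : inner ℝ (subgradL2 ybar.fst W.fst) (v - ybar).fst ≤
        normL1 v.fst - normL1 ybar.fst := inner_subgradL2_sub_le _ _ _
    have h4 := mul_le_mul_of_nonneg_left (hf v hv) (sub_nonneg.2 ht1)
    have h5 := mul_le_mul_of_nonneg_left h3 ht.le
    rw [h1]
    linarith
  · intro t ht _
    rw [norm_smul, Real.norm_of_nonneg ht.le, mul_comm]
  · intro t _ _
    rw [real_inner_smul_right]

/-- The heart of the argument: the curve `ybar + t • W` is made feasible by a control correction of
size O(t) whose pairing with `ubar - ud` is at most `-t * a W W`. -/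
theorem IsLocalSolution.mul_a_le [NeZero d] {Ω : Set (Rd d)} (hΩ : IsOpen Ω)
    (hbdd : Bornology.IsBounded Ω) {𝒯 : Mesh Ω} {ν : ℝ} (hν : 0 < ν)
    {yd ud : L2 Ω} {ybar : Pair Ω} {ubar : L2 Ω} (hloc : IsLocalSolution 𝒯 ν yd ud ybar ubar)
    {W : Pair Ω} (hW : W ∈ Vh 𝒯) (hWu : W.fst = -(ubar - ud)) :
    ν * a W W ≤ inner ℝ (ybar.fst - yd) W.fst := by
  have := isFiniteMeasure_restrict_of_isBounded hbdd
  have := finiteDimensional_VhFst hΩ hbdd 𝒯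
  have hy := hloc.1.1
  have hyU : ybar.fst ∈ VhFst 𝒯 := ⟨ybar, hy, rfl⟩
  have hWU : W.fst ∈ VhFst 𝒯 := ⟨W, hW, rfl⟩
  have hcrit := hloc.integral_absDeriv_le hΩ hbdd hν hW hWu
  obtain ⟨h, hh⟩ := exists_inner_eq_a hΩ hbdd 𝒯 W
  obtain ⟨C, hC0, hC⟩ := exists_inner_jumpL2_le (hasThinSublevels_of_mem_VhFst hΩ hyU)
    (isEssBounded_of_mem_VhFst hΩ hWU)
  obtain ⟨B, hB0, hB⟩ := exists_ae_abs_le_mul_norm (VhFst 𝒯)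
    fun v hv => isEssBounded_of_mem_VhFst hΩ hv
  set G : ℝ → L2 Ω := fun t => jumpL2 ybar.fst (t • W.fst) with hG
  set Q : ℝ → L2 Ω := fun t => (VhFst 𝒯).starProjection (G t) with hQ
  have hQz : ∀ t, ∀ z ∈ VhFst 𝒯, inner ℝ (Q t) z = inner ℝ (G t) z := by
    intro t z hz
    have := (VhFst 𝒯).starProjection_inner_eq_zero (G t) z hz
    rw [inner_sub_left] at this
    linarith
  have hQn : ∀ t > 0, ‖Q t‖ ≤ C * B * t := by
    intro t ht
    have hmem : Q t ∈ VhFst 𝒯 := Submodule.starProjection_apply_mem _ _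
    -- Pair the jump with its own projection, whose maximum norm is at most `B * ‖Q t‖`; cancelling
    -- one factor leaves the rate `t`.
    have h1 : ‖Q t‖ * ‖Q t‖ ≤ C * t * (B * ‖Q t‖) := by
      rw [← real_inner_self_eq_norm_mul_norm, hQz t _ hmem]
      exact hC t ht _ _ (hB _ hmem) (by positivity)
    rcases (norm_nonneg (Q t)).eq_or_lt with h0 | h0
    · rw [← h0]; positivity
    · refine le_of_mul_le_mul_right ?_ h0
      linarith
  have := hloc.first_order hν W (fun t => Q t + t • h) (C := C * B + ‖h‖) (κ := -a W W)
    (by positivity) ?_ ?_ ?_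
  · linarith
  · intro t ht _
    rw [isFeasible_iff]
    have hyt : ybar + t • W ∈ Vh 𝒯 := (Vh 𝒯).add_mem hy ((Vh 𝒯).smul_mem t hW)
    refine ⟨hyt, fun v hv => ?_⟩
    set z := v - (ybar + t • W) with hz
    have hzV : z ∈ Vh 𝒯 := (Vh 𝒯).sub_mem hv hyt
    have h1 : residual (ybar + t • W) (ubar + (Q t + t • h)) z =
        residual ybar ubar z + inner ℝ (G t) z.fst := by
      rw [residual_add_left]
      congr 1
      rw [residual, inner_add_left, real_inner_smul_left, hh z hzV, hQz t z.fst ⟨z, hzV, rfl⟩]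
      simp only [a, WithLp.smul_snd, real_inner_smul_left]
      ring
    -- The first two terms are bounded above by directional derivatives, as for any feasible point.
    -- The subtracted one needs the opposite bound, which is criticality of `W`.
    have h2 : residual ybar ubar z = residual ybar ubar v + residual ybar ubar (-ybar) -
        t * residual ybar ubar W := by
      have : z = v + -ybar + (-t) • W := by rw [hz, neg_smul]; abel
      rw [this, residual_add, residual_add, residual_smul]
      ring
    have h3 := hloc.1.residual_le hΩ hbdd hv
    have h4 : residual ybar ubar (-ybar) ≤ -normL1 ybar.fst := by
      rw [← integral_absDeriv_neg_self]
      exact hloc.1.residual_le hΩ hbdd ((Vh 𝒯).neg_mem hy)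
    have h5 := integral_absDeriv_add_inner_jumpL2_le ybar.fst (t • W.fst) v.fst
    rw [integral_absDeriv_smul _ _ ht.le] at h5
    have h6 := mul_le_mul_of_nonneg_left hcrit ht.le
    have h7 : z.fst = v.fst - (ybar.fst + t • W.fst) := rfl
    have h8 : (ybar + t • W).fst = ybar.fst + t • W.fst := rfl
    rw [h1, h2, h7, h8]
    linarith
  · intro t ht _
    refine (norm_add_le _ _).trans ?_
    rw [norm_smul, Real.norm_of_nonneg ht.le]
    linarith [hQn t ht]
  · intro t ht _
    have h1 := inner_jumpL2_self_nonneg ybar.fst (t • W.fst)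
    rw [real_inner_smul_right] at h1
    have h2 := nonneg_of_mul_nonneg_right h1 ht
    have h3 : inner ℝ (ubar - ud) (Q t + t • h) =
        -(inner ℝ (G t) W.fst + t * a W W) := by
      have : ubar - ud = -W.fst := by rw [hWu, neg_neg]
      rw [this, inner_neg_left, real_inner_comm, inner_add_left, real_inner_smul_left, hh W hW,
        hQz t _ hWU]
    rw [h3]
    linarith

end DiscreteVI

end

/-! ### Conclusion: the norm estimate -/

theorem proposition3p2 {d : ℕ} (hd : 1 ≤ d) (Ω : Set (DiscreteVI.Rd d)) (hΩ : IsOpen Ω)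
    (hbdd : Bornology.IsBounded Ω) (𝒯 : DiscreteVI.Mesh Ω) (ν : ℝ) (hν : 0 < ν)
    (yd ud : DiscreteVI.L2 Ω) :
    (∃ c : ℝ, DiscreteVI.IsCoercivityConstant Ω c) ∧
    ∀ (ybar : DiscreteVI.Pair Ω) (ubar : DiscreteVI.L2 Ω),
      DiscreteVI.IsLocalSolution 𝒯 ν yd ud ybar ubar →
      ∃ w ∈ DiscreteVI.Vh 𝒯, w.fst = ubar - ud ∧
        ∀ c : ℝ, DiscreteVI.IsCoercivityConstant Ω c →
          ‖w‖ ≤ 1 / (ν * c) * (‖ybar.fst‖ + ‖yd‖) := by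
  have : NeZero d := ⟨by omega⟩
  refine ⟨DiscreteVI.exists_isCoercivityConstant hd hbdd, fun ybar ubar hloc => ?_⟩
  obtain ⟨w, hw, hwu⟩ := hloc.sub_mem_VhFst hΩ hbdd hν
  replace hwu : w.fst = ubar - ud := hwu
  refine ⟨w, hw, hwu, fun c hc => ?_⟩
  have hnu : (-w).fst = -(ubar - ud) := by rw [WithLp.neg_fst, hwu]
  have h1 := hloc.mul_a_le hΩ hbdd hν ((DiscreteVI.Vh 𝒯).neg_mem hw) hnu
  have h2 := hc.2 (-w) ((DiscreteVI.H10 Ω).neg_mem hw.1)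
  have h3 : inner ℝ (ybar.fst - yd) (-w).fst ≤ (‖ybar.fst‖ + ‖yd‖) * ‖w‖ := by
    refine (real_inner_le_norm _ _).trans ?_
    have h4 : ‖(-w).fst‖ ≤ ‖w‖ := by
      rw [WithLp.neg_fst, norm_neg]
      exact WithLp.norm_fst_le _ w
    gcongr
    exact norm_sub_le _ _
  rw [norm_neg] at h2
  have hνc : 0 < ν * c := mul_pos hν hc.1
  rw [one_div, ← div_eq_inv_mul, le_div_iff₀ hνc]
  -- The chain bounds `ν * c * ‖w‖ ^ 2` by a multiple of `‖w‖`, so one factor must be cancelled.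
  rcases (norm_nonneg w).eq_or_lt with h0 | h0
  · rw [← h0, zero_mul]; positivity
  · refine le_of_mul_le_mul_right ?_ h0
    have h5 := mul_le_mul_of_nonneg_left h2 hν.le
    calc ‖w‖ * (ν * c) * ‖w‖ = ν * (c * ‖w‖ ^ 2) := by ring
      _ ≤ _ := h5.trans (h1.trans h3)
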